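/- **Setting.** There are $K\ge 2$ platforms, a user and a data buyer. The user's feature vector is $\theta\sim\mathcal N(0,I_d)$. Platform $i$ has a unit vector $x_i\in\mathbb R^d$ and a cost $c_i\ge 0$; the buyer has a unit vector $y\in\mathbb R^d$. Put $\gamma_i=x_i^\top y$. If the user shares with platform $i$, the platform receives $s_i=x_i^\top\theta+w_i$, and if it sells the data with noise level $\sigma_i\ge 0$, the buyer receives $\tilde s_i=s_i+\sigma_i n_i$, where $w_i,n_i\sim\mathcal N(0,1)$ and $\theta$ and all $w_i,n_i$ are independent. The information about $Z$ revealed by signals $\mathcal S$ is $\mathcal I(Z\mid\mathcal S)=\mathbb E[(Z-\mathbb E Z)^2]-\mathbb E[(Z-\mathbb E[Z\mid\mathcal S])^2]$. Write $\mathcal I_i=\mathcal I(x_i^\top\theta\mid s_i)$ and $\mathcal I(\sigma_S)=\mathcal I(y^\top\theta\mid(\tilde s_i)_{i\in S})$. **Game.** (1) The platforms simultaneously choose noise levels $\sigma_i\ge0$ and whether to enter; let $E$ be the set of entrants. (2) The user chooses the set $A\subseteq E$ of platforms to share with. (3) The platforms simultaneously choose prices $p_i\in\mathbb R$. (4) The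 buyer chooses the set $B\subseteq A$ of platforms whose data to purchase. The user's utility is $\sum_{i\in A}\mathcal I_i-\alpha\,\mathcal I(\sigma_B)$ and the buyer's utility is $\beta\,\mathcal I(\sigma_B)-\sum_{i\in B}p_i$, with $\beta>0$. Platform $i$'s utility is $\mathcal I_i\mathbf 1_{i\in A}+p_i\mathbf 1_{i\in B}-c_i$ if $i\in E$ and $0$ otherwise. An equilibrium is a pure-strategy subgame perfect equilibrium in which the user always takes the largest of her optimal sets $A$. **Assumptions.** (1) $(x_i-\gamma_iy)^\top(x_j-\gamma_jy)=0$ for all $i\ne j$. (2) $\alpha$ is such that, for every set $E$ of entrants, if all noise levels are zero and the buyer purchases everything offered, the user's only optimal choice is to share with nobody. **Theorem.** Suppose Assumptions 1 and 2 hold. There are thresholds $\bar\alpha$, $\bar\beta$ and $\underline\beta>0$ such that for $\alpha\ge\bar\alpha$ the following holds. Here $\bar\alpha$ depends only on $K$ and $\min_i|\gamma_i|$; $\underline\beta$ depends only on $K$ and the $x_i,y,c_i$; and $\bar\beta$ may also depend on $\alpha$. - If $\beta\ge\bar\beta$, an equilibrium exists. Moreover, in every equilibrium all platforms enter, the user's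 utility is zero, and the buyer purchases the data of all platforms and has strictly positive utility. - If $0<\beta\le\underline\beta$ and no $c_i$ equals $1/2$, an equilibrium exists. Moreover, in every equilibrium the set of entrants is exactly the set of low-cost platforms ($c_i<1/2$), the user's utility is zero, the buyer purchases the data of exactly these platforms, and the buyer's utility is strictly positive if and only if there are at least two low-cost platforms. -/

import Mathlib

open MeasureTheory ProbabilityTheory
open scoped NNReal

namespace DataMarket

/-- The information about `Z` revealed by the family of signals `S`: the reduction of the
mean-squared error of `Z` when its prior mean is replaced by its posterior mean given `S`. -/
noncomputable def revealedInfo {Ω : Type*} [MeasurableSpace Ω] (μ : Measure Ω) {ι : Type*}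
    (Z : Ω → ℝ) (S : ι → Ω → ℝ) : ℝ :=
  (∫ ω, (Z ω - ∫ ω', Z ω' ∂μ) ^ 2 ∂μ) -
    ∫ ω, (Z ω - (μ[Z | MeasurableSpace.comap (fun ω i => S i ω) MeasurableSpace.pi]) ω) ^ 2 ∂μ

/-- The sample space: the feature vector `θ` of the user, the standard noises in the signals that
the platforms receive, and the standard noises that the platforms scale and add before selling. -/
abbrev Sample (d K : ℕ) : Type := EuclideanSpace ℝ (Fin d) × (Fin K → ℝ) × (Fin K → ℝ)

/-- All the primitive random variables are independent and standard Gaussian. -/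
noncomputable def law (d K : ℕ) : Measure (Sample d K) :=
  (stdGaussian (EuclideanSpace ℝ (Fin d))).prod
    ((Measure.pi fun _ : Fin K => gaussianReal 0 1).prod
      (Measure.pi fun _ : Fin K => gaussianReal 0 1))

/-- The fixed data of a market with `K` platforms: the unit characteristic vectors `x i` of the
platforms and `y` of the buyer, and the nonnegative service costs `c i`. -/
structure Market (d K : ℕ) where
  x : Fin K → EuclideanSpace ℝ (Fin d)
  y : EuclideanSpace ℝ (Fin d)
  c : Fin K → ℝ
  norm_x : ∀ i, ‖x i‖ = 1
  norm_y : ‖y‖ = 1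
  c_nonneg : ∀ i, 0 ≤ c i

namespace Market

variable {d K : ℕ} (M : Market d K)

/-- The correlation `γ i` of platform `i` with the buyer. -/
noncomputable def corr (i : Fin K) : ℝ := inner ℝ (M.x i) M.y

/-- The smallest absolute correlation. -/
noncomputable def minCorr : ℝ := ⨅ i, |M.corr i|

/-- The data of the platforms are substitutes: the components of the `x i` orthogonal to `y` are
pairwise orthogonal. -/
def Substitutes : Prop :=
  ∀ i j, i ≠ j → inner ℝ (M.x i - M.corr i • M.y) (M.x j - M.corr j • M.y) = (0 : ℝ)

/-- The quantity that platform `i` wants to know. -/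
noncomputable def platformTarget (i : Fin K) (ω : Sample d K) : ℝ := inner ℝ (M.x i) ω.1

/-- The quantity that the buyer wants to know. -/
noncomputable def buyerTarget (ω : Sample d K) : ℝ := inner ℝ M.y ω.1

/-- The signal that platform `i` receives from the user. -/
noncomputable def signal (i : Fin K) (ω : Sample d K) : ℝ := M.platformTarget i ω + ω.2.1 i

/-- The signal that platform `i` sells: noise of standard deviation `σ i` is added. -/
noncomputable def soldSignal (σ : Fin K → ℝ≥0) (i : Fin K) (ω : Sample d K) : ℝ :=
  M.signal i ω + (σ i : ℝ) * ω.2.2 i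

/-- The information `𝓘_i` revealed to a platform that receives its signal. -/
noncomputable def platformInfo (i : Fin K) : ℝ :=
  revealedInfo (law d K) (M.platformTarget i) (fun _ : Unit => M.signal i)

/-- The information `𝓘(σ_S)` revealed to a buyer who obtains the data of the platforms in `S`. -/
noncomputable def buyerInfo (σ : Fin K → ℝ≥0) (S : Finset (Fin K)) : ℝ :=
  revealedInfo (law d K) M.buyerTarget (fun i : S => M.soldSignal σ i)

/- Profiles in `{0,1}^K` are written as sets of platforms: `E` is the set of the platforms that
enter, `A` of those with which the user shares, `B` of those from which the buyer purchases. -/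

noncomputable def userUtility (α : ℝ) (σ : Fin K → ℝ≥0) (E A B : Finset (Fin K)) : ℝ :=
  (∑ i ∈ E ∩ A, M.platformInfo i) - α * M.buyerInfo σ (E ∩ A ∩ B)

noncomputable def platformUtility (i : Fin K) (E A : Finset (Fin K)) (p : Fin K → ℝ)
    (B : Finset (Fin K)) : ℝ :=
  if i ∈ E then
    (if i ∈ A then M.platformInfo i else 0) + (if i ∈ B then p i else 0) - M.c i
  else 0

noncomputable def buyerUtility (β : ℝ) (σ : Fin K → ℝ≥0) (E A : Finset (Fin K)) (p : Fin K → ℝ)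
    (B : Finset (Fin K)) : ℝ :=
  β * M.buyerInfo σ (E ∩ A ∩ B) - ∑ i ∈ B, p i

/-- The optimal sharing decisions of the user when `E` is the set of entrants and the buyer
purchases all the data that are offered. -/
def userEquilibria (α : ℝ) (σ : Fin K → ℝ≥0) (E : Finset (Fin K)) : Set (Finset (Fin K)) :=
  {A | A ⊆ E ∧ ∀ A' ⊆ E, M.userUtility α σ E A' A' ≤ M.userUtility α σ E A A}

/-- The user asks for some privacy: at noise level zero, whichever platforms enter, the highest
optimal decision is to share with none of them. -/
def PrivacyConcerned (α : ℝ) : Prop :=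
  ∀ E : Finset (Fin K), IsGreatest (M.userEquilibria α (fun _ => 0) E) ∅

end Market

/-- A pure strategy profile of the four-stage game: the platforms' noise levels and entry
decisions, and then the plans of the user, of the platforms as price setters, and of the buyer, each
as a function of everything chosen before. -/
structure Profile (K : ℕ) where
  noise : Fin K → ℝ≥0
  entry : Finset (Fin K)
  share : (Fin K → ℝ≥0) → Finset (Fin K) → Finset (Fin K)
  price : (Fin K → ℝ≥0) → Finset (Fin K) → Finset (Fin K) → Fin K → ℝ
  buy : (Fin K → ℝ≥0) → Finset (Fin K) → Finset (Fin K) → (Fin K → ℝ) → Finset (Fin K)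

namespace Profile

variable {K : ℕ} (s : Profile K)

/-- The prices that follow `(σ, E)`. -/
def priceAt (σ : Fin K → ℝ≥0) (E : Finset (Fin K)) : Fin K → ℝ :=
  s.price σ E (s.share σ E)

/-- The purchases that follow `(σ, E, A)`. -/
def buyAfter (σ : Fin K → ℝ≥0) (E A : Finset (Fin K)) : Finset (Fin K) :=
  s.buy σ E A (s.price σ E A)

/-- The purchases that follow `(σ, E)`. -/
def buyAt (σ : Fin K → ℝ≥0) (E : Finset (Fin K)) : Finset (Fin K) :=
  s.buyAfter σ E (s.share σ E)

/-- The set of platforms from which the buyer purchases on the path of play. -/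
def purchased : Finset (Fin K) := s.buyAt s.noise s.entry

end Profile

namespace Market

variable {d K : ℕ} (M : Market d K)

/-- The payoff of platform `i` after the first-stage choices `(σ, E)`, when the later stages
follow `s`. -/
noncomputable def continuationPayoff (s : Profile K) (i : Fin K) (σ : Fin K → ℝ≥0)
    (E : Finset (Fin K)) : ℝ :=
  M.platformUtility i E (s.share σ E) (s.priceAt σ E) (s.buyAt σ E)

/-- The sharing decisions that are optimal for the user after `(σ, E)`, when the later stages
follow `s`. -/
def optimalShares (α : ℝ) (s : Profile K) (σ : Fin K → ℝ≥0) (E : Finset (Fin K)) :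
    Set (Finset (Fin K)) :=
  {A | A ⊆ E ∧ ∀ A' ⊆ E,
    M.userUtility α σ E A' (s.buyAfter σ E A') ≤ M.userUtility α σ E A (s.buyAfter σ E A)}

/-- Subgame perfect equilibrium, in which the user breaks ties in favor of the platforms. The user
can share only with entrants, and only platforms that hold the data of the user can offer them. -/
structure IsEquilibrium (α β : ℝ) (s : Profile K) : Prop where
  /-- The buyer chooses optimally, whatever was chosen before. -/
  buyer : ∀ (σ : Fin K → ℝ≥0) (E A : Finset (Fin K)), A ⊆ E → ∀ p : Fin K → ℝ,
    s.buy σ E A p ⊆ A ∧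
      ∀ B ⊆ A, M.buyerUtility β σ E A p B ≤ M.buyerUtility β σ E A p (s.buy σ E A p)
  /-- No platform gains by changing its price, whatever was chosen before. -/
  pricing : ∀ (σ : Fin K → ℝ≥0) (E A : Finset (Fin K)), A ⊆ E → ∀ (i : Fin K) (q : ℝ),
    M.platformUtility i E A (Function.update (s.price σ E A) i q)
        (s.buy σ E A (Function.update (s.price σ E A) i q)) ≤
      M.platformUtility i E A (s.price σ E A) (s.buy σ E A (s.price σ E A))
  /-- The user takes the highest optimal decision, whatever was chosen before. -/
  user : ∀ (σ : Fin K → ℝ≥0) (E : Finset (Fin K)),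
    IsGreatest (M.optimalShares α s σ E) (s.share σ E)
  /-- No platform gains by changing its noise level and its entry decision. -/
  platform : ∀ (i : Fin K) (t : ℝ≥0) (E' : Finset (Fin K)),
    (E' = insert i s.entry ∨ E' = s.entry.erase i) →
      M.continuationPayoff s i (Function.update s.noise i t) E' ≤
        M.continuationPayoff s i s.noise s.entry

/-- The utility of the user on the path of play. -/
noncomputable def userOutcome (α : ℝ) (s : Profile K) : ℝ :=
  M.userUtility α s.noise s.entry (s.share s.noise s.entry) s.purchased

/-- The utility of the buyer on the path of play. -/
noncomputable def buyerOutcome (β : ℝ) (s : Profile K) : ℝ :=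
  M.buyerUtility β s.noise s.entry (s.share s.noise s.entry) (s.priceAt s.noise s.entry)
    s.purchased

/-- The low-cost platforms. -/
noncomputable def lowCost : Finset (Fin K) := Finset.univ.filter fun i => M.c i < 1 / 2

end Market

end DataMarket

namespace DataMarket

/-! Under `Substitutes` the platforms' signals are conditionally independent given y ⬝ θ, so the
precisions of the sold signals add up: data of total precision T reveal `gain` T = T / (1 + T) to
the buyer, while each platform always learns 1/2 for itself. Concavity of `gain` makes information
submodular, and the game can be solved backwards.

After any sharing decision, every platform sells, at β times the marginal information of its data
(`buyAfter_eq_and_price_eq`). The user therefore maximises |A|/2 − α · information, a supermodular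
function of A, whose maximisers form a lattice with a greatest and a least element.

The user's utility is zero for the following reason. Suppose that she shares with all entrants and
gains strictly. A platform with positive noise that belongs to every optimal set could reduce its
noise slightly, still be shared with, and charge more. Hence all members of the least optimal set
add no noise, and a positive value there contradicts `PrivacyConcerned`.

Entry is decided by two bounds. Data of precision 1/(2α) are always shared, which guarantees an
entrant 1/2 plus a fixed multiple of β; and no entrant ever collects 1/2 + β. For large or small β
these bounds decide for every platform (`entry_eq`).

For existence, all intended entrants offer one common precision that leaves the user indifferent
between sharing with all of them and with none. The delicate deviation is one after which the user
drops some rivals; `gain_deviation_le` shows that it does not raise the deviator's price. -/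

/-! ### Gaussian regression. -/

/-- The σ-algebra generated by a family of signals. -/
abbrev signalAlgebra {Ω ι : Type*} (S : ι → Ω → ℝ) : MeasurableSpace Ω :=
  MeasurableSpace.comap (fun ω i => S i ω) MeasurableSpace.pi

/-- For jointly Gaussian variables, the revealed information is given by the normal equations of
linear regression. -/
theorem revealedInfo_eq_sum {Ω : Type*} [mΩ : MeasurableSpace Ω] {μ : Measure Ω}
    {ι : Type*} [Fintype ι] {Z : Ω → ℝ} {S : ι → Ω → ℝ} (hZ : Measurable Z)
    (hS : ∀ i, Measurable (S i)) (hG : HasGaussianLaw (fun ω => (Z ω, fun i => S i ω)) μ)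
    (a : ι → ℝ) (h : ∀ j, ∑ i, a i * cov[S i, S j; μ] = cov[Z, S j; μ]) :
    revealedInfo μ Z S = ∑ i, a i * cov[S i, Z; μ] := by
  have := hG.isProbabilityMeasure
  set L : Ω → ℝ := fun ω => ∑ i, a i * S i ω with hL
  set R : Ω → ℝ := fun ω => Z ω - L ω with hR
  have hSL : ∀ i, MemLp (S i) 2 μ := fun i => (hG.snd.eval i).memLp_two
  have hZL : MemLp Z 2 μ := hG.fst.memLp_two
  have hLm : Measurable L := Finset.measurable_sum _ fun i _ => (hS i).const_mul _
  have hLL : MemLp L 2 μ := memLp_finsetSum _ fun i _ => (hSL i).const_mul _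
  have hRL : MemLp R 2 μ := hZL.sub hLL
  have covL : ∀ Y : Ω → ℝ, MemLp Y 2 μ → cov[L, Y; μ] = ∑ i, a i * cov[S i, Y; μ] := by
    intro Y hY
    rw [hL, covariance_fun_sum_left (fun i => (hSL i).const_mul _) hY]
    simp_rw [covariance_const_mul_left]
  have covRS : ∀ j, cov[R, S j; μ] = 0 := by
    intro j
    rw [hR, covariance_fun_sub_left hZL hLL (hSL j), covL _ (hSL j), h, sub_self]
  have covRL : cov[R, L; μ] = 0 := by
    rw [covariance_comm, covL R hRL]
    exact Finset.sum_eq_zero fun i _ => by rw [covariance_comm, covRS, mul_zero]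
  -- Zero covariance gives independence of residual and signals only for a jointly Gaussian pair,
  -- obtained here as a linear image of (Z, S).
  have hG' : HasGaussianLaw (fun ω => ((fun _ : Unit => R ω), fun i => S i ω)) μ := by
    let T : (ℝ × (ι → ℝ)) →L[ℝ] ((Unit → ℝ) × (ι → ℝ)) :=
      (ContinuousLinearMap.pi fun _ => ContinuousLinearMap.fst ℝ ℝ (ι → ℝ) -
        ∑ i, a i • (ContinuousLinearMap.proj i).comp (ContinuousLinearMap.snd ℝ ℝ (ι → ℝ))).prod
        (ContinuousLinearMap.snd ℝ ℝ (ι → ℝ))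
    have e : (fun ω => ((fun _ : Unit => R ω), fun i => S i ω)) =
        fun ω => T (Z ω, fun i => S i ω) := by
      funext ω
      ext <;> simp [T, hR, hL]
    rw [e]
    exact hG.map_fun T
  have hI := (hG'.indepFun_of_covariance_eval (X := fun _ : Unit => R) fun _ j => covRS j).comp
    (measurable_pi_apply ()) measurable_id
  have hmle : signalAlgebra S ≤ mΩ := (measurable_pi_lambda _ hS).comap_le
  have hLmm : StronglyMeasurable[signalAlgebra S] L := by
    refine Measurable.stronglyMeasurable ?_
    refine Finset.measurable_sum _ fun i _ => Measurable.const_mul ?_ _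
    exact (measurable_pi_apply i).comp (comap_measurable fun ω i => S i ω)
  have hRce : μ[R | signalAlgebra S] =ᵐ[μ] fun _ => μ[R] := by
    refine condExp_indep_eq (hZ.sub hLm).comap_le hmle ?_ hI
    exact (comap_measurable R).stronglyMeasurable
  have hZce : μ[Z | signalAlgebra S] =ᵐ[μ] fun ω => L ω + μ[R] := by
    have hsum : Z = L + R := by ext ω; simp [hR]
    have h1 := condExp_add (hLL.integrable one_le_two) (hRL.integrable one_le_two)
      (signalAlgebra S) (μ := μ)
    rw [← hsum, condExp_of_stronglyMeasurable hmle hLmm (hLL.integrable one_le_two)] at h1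
    filter_upwards [h1, hRce] with ω h1 h2
    rw [h1, Pi.add_apply, h2]
  have e1 : ∫ ω, (Z ω - ∫ ω', Z ω' ∂μ) ^ 2 ∂μ = cov[Z, Z; μ] := by
    rw [covariance_self hZ.aemeasurable, variance_eq_integral hZ.aemeasurable]
  have e2 : ∫ ω, (Z ω - (μ[Z | signalAlgebra S]) ω) ^ 2 ∂μ = cov[R, R; μ] := by
    have hRm : AEMeasurable R μ := (hZ.sub hLm).aemeasurable
    rw [covariance_self hRm, variance_eq_integral hRm]
    refine integral_congr_ae ?_
    filter_upwards [hZce] with ω hω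
    rw [hω]
    simp only [hR]
    ring
  have e3 : cov[R, R; μ] = cov[Z, Z; μ] - cov[L, Z; μ] := by
    nth_rw 2 [hR]
    rw [covariance_fun_sub_right hRL hZL hLL, covRL, sub_zero, hR,
      covariance_fun_sub_left hZL hLL hZL]
  rw [revealedInfo, e1, e2, e3, covL Z hZL]
  ring

/-! ### Covariances of the primitive variables and of the signals. -/

variable {d K : ℕ}

theorem iIndepFun_eval_pi (K : ℕ) : iIndepFun (fun (i : Fin K) (z : Fin K → ℝ) => z i)
    (Measure.pi fun _ : Fin K => gaussianReal 0 1) := by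
  have h : ∀ _ : Fin K, AEMeasurable (id : ℝ → ℝ) (gaussianReal 0 1) := fun _ => by fun_prop
  exact iIndepFun_pi h

theorem map_eval_pi_gaussianReal (i : Fin K) :
    (Measure.pi fun _ : Fin K => gaussianReal 0 1).map (fun z => z i) = gaussianReal 0 1 :=
  (measurePreserving_eval _ i).map_eq

instance isGaussian_pi_gaussianReal (K : ℕ) :
    IsGaussian (Measure.pi fun _ : Fin K => gaussianReal 0 1) := by
  have h := (iIndepFun_eval_pi K).hasGaussianLaw fun i => ⟨by
      rw [map_eval_pi_gaussianReal]; infer_instance⟩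
  simpa using! h.isGaussian_map

instance isGaussian_law (d K : ℕ) : IsGaussian (law d K) := by
  unfold law; infer_instance

theorem memLp_law (L : Sample d K →L[ℝ] ℝ) : MemLp L 2 (law d K) :=
  IsGaussian.memLp_dual _ L 2 (by simp)

/-- The component of the feature vector in a direction. -/
noncomputable def featureForm (d K : ℕ) (u : EuclideanSpace ℝ (Fin d)) : Sample d K →L[ℝ] ℝ :=
  (innerSL ℝ u).comp (ContinuousLinearMap.fst ℝ _ _)

/-- The noise received by a platform. -/
noncomputable def receivedForm (d K : ℕ) (i : Fin K) : Sample d K →L[ℝ] ℝ :=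
  (ContinuousLinearMap.proj i).comp
    ((ContinuousLinearMap.fst ℝ _ _).comp (ContinuousLinearMap.snd ℝ _ _))

/-- The unscaled noise added by a platform. -/
noncomputable def addedForm (d K : ℕ) (i : Fin K) : Sample d K →L[ℝ] ℝ :=
  (ContinuousLinearMap.proj i).comp
    ((ContinuousLinearMap.snd ℝ _ _).comp (ContinuousLinearMap.snd ℝ _ _))

theorem covariance_eval_pi (i j : Fin K) :
    cov[fun z : Fin K → ℝ => z i, fun z => z j; Measure.pi fun _ : Fin K => gaussianReal 0 1] =
      if i = j then 1 else 0 := by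
  have hm : ∀ i : Fin K, MemLp (fun z : Fin K → ℝ => z i) 2
      (Measure.pi fun _ : Fin K => gaussianReal 0 1) := fun i =>
    IsGaussian.memLp_dual _ (ContinuousLinearMap.proj (R := ℝ) (φ := fun _ : Fin K => ℝ) i) 2
      (by simp)
  split_ifs with h
  · subst h
    have := covariance_map_fun (X := id) (Y := id) (Z := fun z : Fin K → ℝ => z i)
      (μ := Measure.pi fun _ : Fin K => gaussianReal 0 1)
      measurable_id.aestronglyMeasurable measurable_id.aestronglyMeasurable
      (measurable_pi_apply i).aemeasurable
    simp only [id] at this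
    rw [← this, map_eval_pi_gaussianReal, covariance_self (by fun_prop), variance_id_gaussianReal]
    simp
  · exact ((iIndepFun_eval_pi K).indepFun h).covariance_eq_zero (hm i) (hm j)

theorem covariance_fst {A B : Type*} [MeasurableSpace A] [MeasurableSpace B] (μ : Measure A)
    (ν : Measure B) [IsProbabilityMeasure μ] [IsProbabilityMeasure ν] {X Y : A → ℝ}
    (hX : Measurable X) (hY : Measurable Y) :
    cov[fun p => X p.1, fun p => Y p.1; μ.prod ν] = cov[X, Y; μ] := by
  have hp := measurePreserving_fst (μ := μ) (ν := ν)
  rw [← covariance_map_fun hX.aestronglyMeasurable hY.aestronglyMeasurable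
    measurable_fst.aemeasurable, hp.map_eq]

theorem covariance_snd {A B : Type*} [MeasurableSpace A] [MeasurableSpace B] (μ : Measure A)
    (ν : Measure B) [IsProbabilityMeasure μ] [IsProbabilityMeasure ν] {X Y : B → ℝ}
    (hX : Measurable X) (hY : Measurable Y) :
    cov[fun p => X p.2, fun p => Y p.2; μ.prod ν] = cov[X, Y; ν] := by
  have hp := measurePreserving_snd (μ := μ) (ν := ν)
  rw [← covariance_map_fun hX.aestronglyMeasurable hY.aestronglyMeasurable
    measurable_snd.aemeasurable, hp.map_eq]

theorem covariance_featureForm (u v : EuclideanSpace ℝ (Fin d)) :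
    cov[featureForm d K u, featureForm d K v; law d K] = inner ℝ u v := by
  have h := covarianceBilin_apply_eq_cov
    (IsGaussian.memLp_two_id (μ := stdGaussian (EuclideanSpace ℝ (Fin d)))) u v
  rw [covarianceBilin_stdGaussian] at h
  refine (covariance_fst (stdGaussian (EuclideanSpace ℝ (Fin d))) _
    (X := fun z => inner ℝ u z) (Y := fun z => inner ℝ v z) (by fun_prop) (by fun_prop)).trans ?_
  rw [innerSL_apply_apply] at h
  exact h.symm

theorem covariance_receivedForm (i j : Fin K) :
    cov[receivedForm d K i, receivedForm d K j; law d K] = if i = j then 1 else 0 := by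
  refine (covariance_snd (stdGaussian (EuclideanSpace ℝ (Fin d))) _
    (X := fun z : (Fin K → ℝ) × (Fin K → ℝ) => z.1 i) (Y := fun z => z.1 j)
    (by fun_prop) (by fun_prop)).trans ?_
  rw [covariance_fst _ _ (X := fun z : Fin K → ℝ => z i) (Y := fun z : Fin K → ℝ => z j)
    (by fun_prop) (by fun_prop), covariance_eval_pi]

theorem covariance_addedForm (i j : Fin K) :
    cov[addedForm d K i, addedForm d K j; law d K] = if i = j then 1 else 0 := by
  refine (covariance_snd (stdGaussian (EuclideanSpace ℝ (Fin d))) _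
    (X := fun z : (Fin K → ℝ) × (Fin K → ℝ) => z.2 i) (Y := fun z => z.2 j)
    (by fun_prop) (by fun_prop)).trans ?_
  rw [covariance_snd _ _ (X := fun z : Fin K → ℝ => z i) (Y := fun z : Fin K → ℝ => z j)
    (by fun_prop) (by fun_prop), covariance_eval_pi]

theorem covariance_featureForm_receivedForm (u : EuclideanSpace ℝ (Fin d)) (i : Fin K) :
    cov[featureForm d K u, receivedForm d K i; law d K] = 0 :=
  covariance_fst_snd_prod (X := innerSL ℝ u)
    (Y := (ContinuousLinearMap.proj i).comp (ContinuousLinearMap.fst ℝ (Fin K → ℝ) (Fin K → ℝ)))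
    (IsGaussian.memLp_dual _ _ 2 (by simp)) (IsGaussian.memLp_dual _ _ 2 (by simp))

theorem covariance_featureForm_addedForm (u : EuclideanSpace ℝ (Fin d)) (i : Fin K) :
    cov[featureForm d K u, addedForm d K i; law d K] = 0 :=
  covariance_fst_snd_prod (X := innerSL ℝ u)
    (Y := (ContinuousLinearMap.proj i).comp (ContinuousLinearMap.snd ℝ (Fin K → ℝ) (Fin K → ℝ)))
    (IsGaussian.memLp_dual _ _ 2 (by simp)) (IsGaussian.memLp_dual _ _ 2 (by simp))

theorem covariance_receivedForm_addedForm (i j : Fin K) :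
    cov[receivedForm d K i, addedForm d K j; law d K] = 0 := by
  refine (covariance_snd (stdGaussian (EuclideanSpace ℝ (Fin d))) _
    (X := fun z : (Fin K → ℝ) × (Fin K → ℝ) => z.1 i) (Y := fun z => z.2 j)
    (by fun_prop) (by fun_prop)).trans ?_
  exact covariance_fst_snd_prod (X := ContinuousLinearMap.proj (R := ℝ) (φ := fun _ : Fin K => ℝ) i)
    (Y := ContinuousLinearMap.proj (R := ℝ) (φ := fun _ : Fin K => ℝ) j)
    (IsGaussian.memLp_dual _ _ 2 (by simp)) (IsGaussian.memLp_dual _ _ 2 (by simp))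

/-- A scaled sum of a feature component and the noises of one platform. -/
noncomputable def signalForm (d K : ℕ) (u : EuclideanSpace ℝ (Fin d)) (i : Fin K) (t : ℝ) :
    Sample d K →L[ℝ] ℝ :=
  featureForm d K u + receivedForm d K i + t • addedForm d K i

theorem covariance_featureForm_signalForm (u v : EuclideanSpace ℝ (Fin d)) (i : Fin K) (t : ℝ) :
    cov[featureForm d K u, signalForm d K v i t; law d K] = inner ℝ u v := by
  simp only [signalForm, FunLike.coe_add, FunLike.coe_smul]
  rw [covariance_add_right (memLp_law _) ((memLp_law _).add (memLp_law _))
    ((memLp_law _).const_smul _), covariance_add_right (memLp_law _) (memLp_law _) (memLp_law _),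
    covariance_smul_right, covariance_featureForm, covariance_featureForm_receivedForm,
    covariance_featureForm_addedForm]
  ring

theorem covariance_signalForm (u v : EuclideanSpace ℝ (Fin d)) (i j : Fin K) (s t : ℝ) :
    cov[signalForm d K u i s, signalForm d K v j t; law d K] =
      inner ℝ u v + if i = j then 1 + s * t else 0 := by
  have h1 : cov[receivedForm d K i, signalForm d K v j t; law d K] = if i = j then 1 else 0 := by
    simp only [signalForm, FunLike.coe_add, FunLike.coe_smul]
    rw [covariance_add_right (memLp_law _) ((memLp_law _).add (memLp_law _))
      ((memLp_law _).const_smul _), covariance_add_right (memLp_law _) (memLp_law _) (memLp_law _),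
      covariance_smul_right, covariance_comm, covariance_featureForm_receivedForm,
      covariance_receivedForm, covariance_receivedForm_addedForm]
    ring
  have h2 : cov[addedForm d K i, signalForm d K v j t; law d K] = if i = j then t else 0 := by
    simp only [signalForm, FunLike.coe_add, FunLike.coe_smul]
    rw [covariance_add_right (memLp_law _) ((memLp_law _).add (memLp_law _))
      ((memLp_law _).const_smul _), covariance_add_right (memLp_law _) (memLp_law _) (memLp_law _),
      covariance_smul_right, covariance_comm, covariance_featureForm_addedForm,
      covariance_comm, covariance_receivedForm_addedForm, covariance_addedForm]
    split_ifs <;> ring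
  rw [show (signalForm d K u i s : Sample d K → ℝ) =
    (featureForm d K u + receivedForm d K i : Sample d K → ℝ) +
      s • (addedForm d K i : _ → ℝ) from rfl,
    covariance_add_left ((memLp_law _).add (memLp_law _)) ((memLp_law _).const_smul _)
    (memLp_law _), covariance_add_left (memLp_law _) (memLp_law _) (memLp_law _),
    covariance_smul_left, h1, h2, covariance_featureForm_signalForm]
  split_ifs <;> ring

/-! ### Closed forms for the revealed information. -/

namespace Market

variable (M : Market d K)

theorem platformTarget_eq (i : Fin K) : M.platformTarget i = featureForm d K (M.x i) := rfl

theorem buyerTarget_eq : M.buyerTarget = featureForm d K M.y := rfl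

theorem signal_eq (i : Fin K) : M.signal i = signalForm d K (M.x i) i 0 := by
  ext ω
  simp [signal, signalForm, platformTarget, featureForm, receivedForm]

theorem soldSignal_eq (σ : Fin K → ℝ≥0) (i : Fin K) :
    M.soldSignal σ i = signalForm d K (M.x i) i (σ i) := by
  ext ω
  simp [soldSignal, signal, signalForm, platformTarget, featureForm, receivedForm, addedForm]

theorem hasGaussianLaw_prodMk {ι : Type*} [Fintype ι] (Z : Sample d K →L[ℝ] ℝ)
    (S : ι → Sample d K →L[ℝ] ℝ) : HasGaussianLaw (fun ω => (Z ω, fun i => S i ω)) (law d K) :=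
  (IsGaussian.hasGaussianLaw_id (μ := law d K)).map_fun (Z.prod (ContinuousLinearMap.pi S))

theorem platformInfo_eq (i : Fin K) : M.platformInfo i = 1 / 2 := by
  rw [platformInfo, platformTarget_eq, signal_eq, revealedInfo_eq_sum (by fun_prop)
    (fun _ => by fun_prop) (hasGaussianLaw_prodMk _ fun _ => signalForm d K (M.x i) i 0)
    (fun _ => 1 / 2)]
  · simp only [Finset.univ_unique, Finset.sum_singleton]
    rw [covariance_comm, covariance_featureForm_signalForm, real_inner_self_eq_norm_sq, M.norm_x]
    norm_num
  · intro _
    simp only [Finset.univ_unique, Finset.sum_singleton]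
    rw [covariance_signalForm, covariance_featureForm_signalForm, real_inner_self_eq_norm_sq,
      M.norm_x]
    norm_num

theorem abs_corr_le_one (i : Fin K) : |M.corr i| ≤ 1 := by
  simpa [corr, M.norm_x, M.norm_y] using abs_real_inner_le_norm (M.x i) M.y

/-- The precision about `y ⬝ θ` of the data sold by platform `i` with noise level `t`. -/
noncomputable def precision (i : Fin K) (t : ℝ≥0) : ℝ :=
  M.corr i ^ 2 / (2 - M.corr i ^ 2 + (t : ℝ) ^ 2)

theorem precision_denom_pos (i : Fin K) (t : ℝ≥0) : 0 < 2 - M.corr i ^ 2 + (t : ℝ) ^ 2 := by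
  have := (sq_le_one_iff_abs_le_one _).2 (M.abs_corr_le_one i)
  nlinarith [sq_nonneg (t : ℝ)]

theorem precision_nonneg (i : Fin K) (t : ℝ≥0) : 0 ≤ M.precision i t :=
  div_nonneg (sq_nonneg _) (M.precision_denom_pos i t).le

/-- The components orthogonal to y contribute nothing, so distinct platforms are correlated only
through y. -/
theorem inner_x_eq (hM : M.Substitutes) {i j : Fin K} (h : i ≠ j) :
    inner ℝ (M.x i) (M.x j) = M.corr i * M.corr j := by
  have := hM i j h
  simp only [inner_sub_left, inner_sub_right, inner_smul_left, inner_smul_right,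
    real_inner_self_eq_norm_sq, M.norm_y, real_inner_comm (M.x j) M.y] at this
  simp only [corr] at this ⊢
  simp at this
  rw [real_inner_comm] at this ⊢
  linarith

/-- Each signal is γ_i (y ⬝ θ) plus noise of variance 2 − γ_i² + σ_i², and these noises are
uncorrelated across platforms; hence precisions add to the prior precision 1. -/
theorem buyerInfo_eq (hM : M.Substitutes) (σ : Fin K → ℝ≥0) (S : Finset (Fin K)) :
    M.buyerInfo σ S = (∑ i ∈ S, M.precision i (σ i)) / (1 + ∑ i ∈ S, M.precision i (σ i)) := by
  set T := ∑ i ∈ S, M.precision i (σ i) with hT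
  have hT0 : 0 ≤ T := Finset.sum_nonneg fun i _ => M.precision_nonneg i _
  set v : Fin K → ℝ := fun i => 2 - M.corr i ^ 2 + (σ i : ℝ) ^ 2 with hv
  have hv0 : ∀ i, v i ≠ 0 := fun i => (M.precision_denom_pos i (σ i)).ne'
  have hcc : ∀ i j : Fin K, cov[signalForm d K (M.x i) i (σ i), signalForm d K (M.x j) j (σ j);
      law d K] = M.corr i * M.corr j + if i = j then v j else 0 := by
    intro i j
    rw [covariance_signalForm]
    split_ifs with h
    · subst h
      rw [real_inner_self_eq_norm_sq, M.norm_x]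
      simp only [hv]; ring
    · rw [M.inner_x_eq hM h]
  have hcy : ∀ i, cov[featureForm d K M.y, signalForm d K (M.x i) i (σ i); law d K] =
      M.corr i := by
    intro i
    rw [covariance_featureForm_signalForm, real_inner_comm]; rfl
  have hTs : ∑ i : S, M.corr i / v i * M.corr i = T := by
    rw [hT, ← Finset.sum_coe_sort S fun i => M.precision i (σ i)]
    refine Finset.sum_congr rfl fun i _ => ?_
    rw [precision]; simp only [hv]; ring
  simp only [buyerInfo, buyerTarget_eq, soldSignal_eq]
  -- The covariance matrix is diagonal plus rank one; these weights come from the Sherman–Morrison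
  -- formula.
  rw [revealedInfo_eq_sum (by fun_prop) (fun _ => by fun_prop) (hasGaussianLaw_prodMk _
    fun i : S => signalForm d K (M.x i) i (σ i))
    (fun i : S => M.corr i / v i / (1 + T))]
  · simp_rw [covariance_comm _ (featureForm d K M.y : Sample d K → ℝ), hcy]
    rw [← hTs, Finset.sum_div, hTs]
    exact Finset.sum_congr rfl fun i _ => by ring
  · intro j
    rw [hcy]
    simp_rw [hcc, mul_add, Finset.sum_add_distrib]
    have h1 : ∑ i : S, M.corr i / v i / (1 + T) * (M.corr i * M.corr j) =
        T / (1 + T) * M.corr j := by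
      rw [← hTs, Finset.sum_div, Finset.sum_mul, hTs]
      exact Finset.sum_congr rfl fun i _ => by ring
    have h2 : ∑ i : S, M.corr i / v i / (1 + T) * (if (i : Fin K) = j then v j else 0) =
        M.corr j / (1 + T) := by
      rw [Finset.sum_eq_single j]
      · have := hv0 j
        simp only [if_true]
        field_simp
      · intro b _ hb
        rw [if_neg (fun h => hb (Subtype.ext h)), mul_zero]
      · simp
    rw [h1, h2]
    field_simp
    ring

end Market

/-! ### The concave function from precision to information. -/

/-- The information about a standard Gaussian variable in data of precision `t`. -/
noncomputable def gain (t : ℝ) : ℝ := t / (1 + t)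

theorem gain_sub {s t : ℝ} (hs : 0 ≤ s) (ht : 0 ≤ t) :
    gain t - gain s = (t - s) / ((1 + s) * (1 + t)) := by
  have : 1 + s ≠ 0 := by positivity
  have : 1 + t ≠ 0 := by positivity
  unfold gain
  field_simp
  ring

theorem gain_zero : gain 0 = 0 := by simp [gain]

theorem gain_lt_one {t : ℝ} (ht : 0 ≤ t) : gain t < 1 := by
  rw [gain, div_lt_one (by positivity)]; linarith

theorem gain_nonneg {t : ℝ} (ht : 0 ≤ t) : 0 ≤ gain t := by
  unfold gain; positivity

theorem gain_lt {s t : ℝ} (hs : 0 ≤ s) (h : s < t) : gain s < gain t := by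
  have ht : 0 ≤ t := hs.trans h.le
  have h1 : 0 < (t - s) / ((1 + s) * (1 + t)) := div_pos (by linarith) (by positivity)
  have := gain_sub hs ht
  linarith

theorem gain_le {s t : ℝ} (hs : 0 ≤ s) (h : s ≤ t) : gain s ≤ gain t := by
  rcases h.eq_or_lt with rfl | h
  · rfl
  · exact (gain_lt hs h).le

theorem le_of_gain_le {s t : ℝ} (ht : 0 ≤ t) (h : gain s ≤ gain t) : s ≤ t := by
  by_contra! hlt
  exact (gain_lt ht hlt).not_ge h

theorem gain_add_sub_le {s x : ℝ} (hs : 0 ≤ s) (hx : 0 ≤ x) : gain (s + x) - gain s ≤ x := by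
  rw [gain_sub hs (by positivity), div_le_iff₀ (by positivity)]
  nlinarith [mul_nonneg hs hx, mul_nonneg hx hx, mul_nonneg (mul_nonneg hs hx) hx,
    mul_nonneg (mul_nonneg hs hx) hs]

theorem gain_diminishing {s x y : ℝ} (hs : 0 ≤ s) (hx : 0 ≤ x) (hy : 0 ≤ y) :
    gain (s + x + y) - gain (s + x) ≤ gain (s + y) - gain s := by
  rw [gain_sub (by positivity) (by positivity), gain_sub hs (by positivity)]
  have e1 : s + x + y - (s + x) = y := by ring
  have e2 : s + y - s = y := by ring
  rw [e1, e2]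
  gcongr <;> linarith

/-- The extra precision may be cut down to e, and the two factors of the denominator are then at
most K + 1 and K + 2. This bounds prices below independently of what rivals do. -/
theorem gain_add_sub_ge {s x e : ℝ} {K : ℕ} (hs : 0 ≤ s) (hsK : s ≤ K) (he : 0 ≤ e) (hx : e ≤ x)
    (he1 : e ≤ 1) : e / ((K + 1) * (K + 2)) ≤ gain (s + x) - gain s := by
  have h1 : gain (s + e) ≤ gain (s + x) := gain_le (by positivity) (by linarith)
  have h2 := gain_sub hs (t := s + e) (by positivity)
  have h3 : e / ((K + 1) * (K + 2)) ≤ (s + e - s) / ((1 + s) * (1 + (s + e))) := by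
    rw [add_sub_cancel_left]
    exact div_le_div_of_nonneg_left he (by positivity)
      (mul_le_mul (by linarith) (by linarith) (by positivity) (by positivity))
  linarith

/-! ### Precisions and submodularity of information. -/

namespace Market

variable {d K : ℕ} (M : Market d K)

theorem precision_pos (hc : ∀ i, M.corr i ≠ 0) (i : Fin K) (t : ℝ≥0) : 0 < M.precision i t :=
  div_pos (by have := hc i; positivity) (M.precision_denom_pos i t)

theorem corr_sq_le_one (i : Fin K) : M.corr i ^ 2 ≤ 1 :=
  (sq_le_one_iff_abs_le_one _).2 (M.abs_corr_le_one i)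

theorem precision_le_one (i : Fin K) (t : ℝ≥0) : M.precision i t ≤ 1 := by
  rw [precision, div_le_one (M.precision_denom_pos i t)]
  nlinarith [M.corr_sq_le_one i, sq_nonneg (t : ℝ)]

theorem precision_strictAnti (hc : ∀ i, M.corr i ≠ 0) (i : Fin K) {s t : ℝ≥0} (h : s < t) :
    M.precision i t < M.precision i s := by
  have h' : (s : ℝ) < t := by exact_mod_cast h
  have := hc i
  have := M.precision_denom_pos i s
  unfold precision
  gcongr

theorem continuous_precision (i : Fin K) : Continuous (M.precision i) := by
  unfold precision
  exact continuous_const.div (by fun_prop) fun t => (M.precision_denom_pos i t).ne'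

/-- Noise can only lower the precision from γ_i² / (2 − γ_i²), which is at least γ_i² / 2; the
latter is the simpler cap used throughout. -/
theorem exists_precision_eq (i : Fin K) {r : ℝ} (hr : 0 < r) (h : r ≤ M.corr i ^ 2 / 2) :
    ∃ t, M.precision i t = r := by
  have hg : 0 < M.corr i ^ 2 := by linarith
  have h1 := M.corr_sq_le_one i
  have h2 : 2 ≤ M.corr i ^ 2 / r := by
    rw [le_div_iff₀ hr]; linarith
  refine ⟨(Real.sqrt (M.corr i ^ 2 / r - (2 - M.corr i ^ 2))).toNNReal, ?_⟩
  rw [precision, Real.coe_toNNReal _ (Real.sqrt_nonneg _), Real.sq_sqrt (by linarith), add_sub_cancel]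
  exact div_div_cancel₀ hg.ne'

/-- The precision about `y ⬝ θ` of the data sold by a set of platforms. -/
noncomputable def total (σ : Fin K → ℝ≥0) (S : Finset (Fin K)) : ℝ :=
  ∑ i ∈ S, M.precision i (σ i)

theorem total_nonneg (σ : Fin K → ℝ≥0) (S : Finset (Fin K)) : 0 ≤ M.total σ S :=
  Finset.sum_nonneg fun i _ => M.precision_nonneg i _

theorem total_le (σ : Fin K → ℝ≥0) (S : Finset (Fin K)) : M.total σ S ≤ K := by
  have h1 : M.total σ S ≤ ∑ i ∈ S, (1 : ℝ) := Finset.sum_le_sum fun i _ => M.precision_le_one i _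
  have h2 : S.card ≤ K := by simpa using Finset.card_le_univ S
  have h3 : (S.card : ℝ) ≤ K := by exact_mod_cast h2
  simp at h1
  linarith

theorem total_pos (hc : ∀ i, M.corr i ≠ 0) (σ : Fin K → ℝ≥0) {S : Finset (Fin K)}
    (hS : S.Nonempty) : 0 < M.total σ S :=
  Finset.sum_pos (fun i _ => M.precision_pos hc i _) hS

theorem total_erase_add (σ : Fin K → ℝ≥0) {S : Finset (Fin K)} {i : Fin K} (h : i ∈ S) :
    M.total σ (S.erase i) + M.precision i (σ i) = M.total σ S :=
  Finset.sum_erase_add _ _ h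

theorem total_insert (σ : Fin K → ℝ≥0) {S : Finset (Fin K)} {i : Fin K} (h : i ∉ S) :
    M.total σ (insert i S) = M.total σ S + M.precision i (σ i) := by
  rw [total, Finset.sum_insert h, add_comm]; rfl

theorem total_congr {σ τ : Fin K → ℝ≥0} {S : Finset (Fin K)} (h : ∀ i ∈ S, σ i = τ i) :
    M.total σ S = M.total τ S :=
  Finset.sum_congr rfl fun i hi => by rw [h i hi]

variable {M} (hM : M.Substitutes)
include hM

theorem buyerInfo_eq_gain (σ : Fin K → ℝ≥0) (S : Finset (Fin K)) :
    M.buyerInfo σ S = gain (M.total σ S) :=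
  M.buyerInfo_eq hM σ S

theorem buyerInfo_empty (σ : Fin K → ℝ≥0) : M.buyerInfo σ ∅ = 0 := by
  rw [buyerInfo_eq_gain hM, total, Finset.sum_empty, gain_zero]

theorem buyerInfo_nonneg (σ : Fin K → ℝ≥0) (S : Finset (Fin K)) : 0 ≤ M.buyerInfo σ S := by
  rw [buyerInfo_eq_gain hM]
  exact gain_nonneg (M.total_nonneg _ _)

theorem buyerInfo_lt_one (σ : Fin K → ℝ≥0) (S : Finset (Fin K)) : M.buyerInfo σ S < 1 := by
  rw [buyerInfo_eq_gain hM]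
  exact gain_lt_one (M.total_nonneg _ _)

theorem buyerInfo_congr {σ τ : Fin K → ℝ≥0} {S : Finset (Fin K)} (h : ∀ i ∈ S, σ i = τ i) :
    M.buyerInfo σ S = M.buyerInfo τ S := by
  rw [buyerInfo_eq_gain hM, buyerInfo_eq_gain hM, M.total_congr h]

/-- A concave function of an additive set function is submodular. -/
theorem buyerInfo_union_add_inter_le (σ : Fin K → ℝ≥0) (A B : Finset (Fin K)) :
    M.buyerInfo σ (A ∪ B) + M.buyerInfo σ (A ∩ B) ≤ M.buyerInfo σ A + M.buyerInfo σ B := by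
  simp only [buyerInfo_eq_gain hM]
  have h1 : M.total σ (A ∩ B) + M.total σ (A \ B) = M.total σ A :=
    Finset.sum_inter_add_sum_sdiff A B _
  have h2 : M.total σ (A ∩ B) + M.total σ (B \ A) = M.total σ B := by
    rw [Finset.inter_comm]; exact Finset.sum_inter_add_sum_sdiff B A _
  have h3 : M.total σ (A ∪ B) + M.total σ (A ∩ B) = M.total σ A + M.total σ B :=
    Finset.sum_union_inter
  have h4 : M.total σ (A ∪ B) = M.total σ (A ∩ B) + M.total σ (A \ B) + M.total σ (B \ A) := by
    linarith
  have := gain_diminishing (M.total_nonneg σ (A ∩ B)) (M.total_nonneg σ (A \ B))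
    (M.total_nonneg σ (B \ A))
  rw [h4, ← h1, ← h2]
  linarith

theorem buyerInfo_insert_sub_le (σ : Fin K → ℝ≥0) {A B : Finset (Fin K)} {i : Fin K} (hBA : B ⊆ A)
    (hi : i ∉ A) : M.buyerInfo σ (insert i A) - M.buyerInfo σ A ≤
      M.buyerInfo σ (insert i B) - M.buyerInfo σ B := by
  have h := buyerInfo_union_add_inter_le hM σ A (insert i B)
  have e1 : A ∪ insert i B = insert i A := by grind
  have e2 : A ∩ insert i B = B := by grind
  rw [e1, e2] at h
  linarith

theorem buyerInfo_sub_erase_le (σ : Fin K → ℝ≥0) {A B : Finset (Fin K)} {i : Fin K} (hBA : B ⊆ A)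
    (hi : i ∈ B) : M.buyerInfo σ A - M.buyerInfo σ (A.erase i) ≤
      M.buyerInfo σ B - M.buyerInfo σ (B.erase i) := by
  have h := buyerInfo_insert_sub_le hM σ (Finset.erase_subset_erase i hBA)
    (Finset.notMem_erase i A)
  rwa [Finset.insert_erase hi, Finset.insert_erase (hBA hi)] at h

theorem buyerInfo_erase_lt (hc : ∀ i, M.corr i ≠ 0) (σ : Fin K → ℝ≥0) {A : Finset (Fin K)}
    {i : Fin K} (hi : i ∈ A) : M.buyerInfo σ (A.erase i) < M.buyerInfo σ A := by
  rw [buyerInfo_eq_gain hM, buyerInfo_eq_gain hM]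
  refine gain_lt (M.total_nonneg _ _) ?_
  have := M.total_erase_add σ hi
  have := M.precision_pos hc i (σ i)
  linarith

/-- Removing the data one at a time, each later removal costs at least its marginal in the full set.
This is why no bundle beats the full offer at competitive prices. -/
theorem sum_marginal_le (σ : Fin K → ℝ≥0) {A B : Finset (Fin K)} (hBA : B ⊆ A) :
    ∑ i ∈ A \ B, (M.buyerInfo σ A - M.buyerInfo σ (A.erase i)) ≤
      M.buyerInfo σ A - M.buyerInfo σ B := by
  have key : ∀ D : Finset (Fin K), D ⊆ A →
      ∑ i ∈ D, (M.buyerInfo σ A - M.buyerInfo σ (A.erase i)) ≤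
        M.buyerInfo σ A - M.buyerInfo σ (A \ D) := by
    intro D
    induction D using Finset.induction_on with
    | empty => simp
    | insert j D hj ih =>
      intro hD
      have h1 := ih fun x hx => hD (Finset.mem_insert_of_mem hx)
      have hjA : j ∈ A := hD (Finset.mem_insert_self j D)
      have h2 := buyerInfo_sub_erase_le hM σ (Finset.sdiff_subset : A \ D ⊆ A)
        (Finset.mem_sdiff.2 ⟨hjA, hj⟩)
      rw [Finset.sum_insert hj, Finset.sdiff_insert]
      linarith
  have := key (A \ B) Finset.sdiff_subset
  rwa [Finset.sdiff_sdiff_eq_self hBA] at this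

omit hM

theorem buyerUtility_eq (M : Market d K) {β : ℝ} {σ : Fin K → ℝ≥0} {E A B : Finset (Fin K)}
    (hA : A ⊆ E) (hB : B ⊆ A) (p : Fin K → ℝ) :
    M.buyerUtility β σ E A p B = β * M.buyerInfo σ B - ∑ i ∈ B, p i := by
  rw [buyerUtility, Finset.inter_eq_right.2 hA, Finset.inter_eq_right.2 hB]

/-! ### The lattice of optimal sharing decisions. -/

/-- The utility of a user who shares with `A`, all of whose data the buyer purchases. -/
noncomputable def sharingValue (M : Market d K) (α : ℝ) (σ : Fin K → ℝ≥0) (A : Finset (Fin K)) :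
    ℝ := A.card / 2 - α * M.buyerInfo σ A

theorem userUtility_eq (M : Market d K) (α : ℝ) (σ : Fin K → ℝ≥0) {E A : Finset (Fin K)}
    (hA : A ⊆ E) : M.userUtility α σ E A A = M.sharingValue α σ A := by
  rw [userUtility, Finset.inter_eq_right.2 hA, Finset.inter_self, sharingValue]
  simp [platformInfo_eq, div_eq_mul_inv]

theorem sharingValue_supermodular (hM : M.Substitutes) {α : ℝ} (hα : 0 ≤ α) (σ : Fin K → ℝ≥0)
    (A B : Finset (Fin K)) :
    M.sharingValue α σ A + M.sharingValue α σ B ≤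
      M.sharingValue α σ (A ∪ B) + M.sharingValue α σ (A ∩ B) := by
  have h1 := mul_le_mul_of_nonneg_left (buyerInfo_union_add_inter_le hM σ A B) hα
  have h2 : ((A ∪ B).card : ℝ) + (A ∩ B).card = A.card + B.card := by
    exact_mod_cast Finset.card_union_add_card_inter A B
  unfold sharingValue
  linarith

theorem sharingValue_empty (hM : M.Substitutes) (α : ℝ) (σ : Fin K → ℝ≥0) :
    M.sharingValue α σ ∅ = 0 := by
  simp [sharingValue, buyerInfo_empty hM]

theorem sharingValue_congr (hM : M.Substitutes) {α : ℝ} {σ τ : Fin K → ℝ≥0} {S : Finset (Fin K)}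
    (h : ∀ i ∈ S, σ i = τ i) : M.sharingValue α σ S = M.sharingValue α τ S := by
  rw [sharingValue, buyerInfo_congr hM h, sharingValue]

/-- `A` is a best set of platforms to share with among the subsets of `E`. -/
def IsBestShare (M : Market d K) (α : ℝ) (σ : Fin K → ℝ≥0) (E A : Finset (Fin K)) : Prop :=
  A ⊆ E ∧ ∀ A' ⊆ E, M.sharingValue α σ A' ≤ M.sharingValue α σ A

theorem exists_isBestShare (M : Market d K) (α : ℝ) (σ : Fin K → ℝ≥0) (E : Finset (Fin K)) :
    ∃ A, M.IsBestShare α σ E A := by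
  obtain ⟨A, hA, h⟩ := Finset.exists_max_image E.powerset (M.sharingValue α σ) ⟨∅, by simp⟩
  exact ⟨A, by simpa using hA, fun A' hA' => h A' (by simpa using hA')⟩

theorem IsBestShare.union (hM : M.Substitutes) {α : ℝ} (hα : 0 ≤ α) {σ : Fin K → ℝ≥0}
    {E A B : Finset (Fin K)} (hA : M.IsBestShare α σ E A) (hB : M.IsBestShare α σ E B) :
    M.IsBestShare α σ E (A ∪ B) := by
  have h := sharingValue_supermodular hM hα σ A B
  have h1 := hB.2 (A ∩ B) (Finset.inter_subset_left.trans hA.1)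
  exact ⟨Finset.union_subset hA.1 hB.1, fun A' hA' => by linarith [hA.2 A' hA']⟩

theorem IsBestShare.inter (hM : M.Substitutes) {α : ℝ} (hα : 0 ≤ α) {σ : Fin K → ℝ≥0}
    {E A B : Finset (Fin K)} (hA : M.IsBestShare α σ E A) (hB : M.IsBestShare α σ E B) :
    M.IsBestShare α σ E (A ∩ B) := by
  have h := sharingValue_supermodular hM hα σ A B
  have h1 := hB.2 (A ∪ B) (Finset.union_subset hA.1 hB.1)
  exact ⟨Finset.inter_subset_left.trans hA.1, fun A' hA' => by linarith [hA.2 A' hA']⟩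

theorem exists_greatest_isBestShare (hM : M.Substitutes) {α : ℝ} (hα : 0 ≤ α) (σ : Fin K → ℝ≥0)
    (E : Finset (Fin K)) : ∃ A, IsGreatest {A | M.IsBestShare α σ E A} A := by
  classical
  obtain ⟨A, hA, h⟩ := Finset.exists_max_image (Finset.univ.filter (M.IsBestShare α σ E))
    Finset.card (by
      obtain ⟨A, hA⟩ := M.exists_isBestShare α σ E
      exact ⟨A, by simpa using hA⟩)
  simp only [Finset.mem_filter, Finset.mem_univ, true_and] at hA h
  refine ⟨A, hA, fun B hB => ?_⟩
  have h1 := h _ (hA.union hM hα hB)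
  have h2 := Finset.eq_of_subset_of_card_le Finset.subset_union_left h1
  rw [h2]
  exact Finset.subset_union_right

theorem exists_least_isBestShare (hM : M.Substitutes) {α : ℝ} (hα : 0 ≤ α) (σ : Fin K → ℝ≥0)
    (E : Finset (Fin K)) : ∃ A, IsLeast {A | M.IsBestShare α σ E A} A := by
  classical
  obtain ⟨A, hA, h⟩ := Finset.exists_min_image (Finset.univ.filter (M.IsBestShare α σ E))
    Finset.card (by
      obtain ⟨A, hA⟩ := M.exists_isBestShare α σ E
      exact ⟨A, by simpa using hA⟩)
  simp only [Finset.mem_filter, Finset.mem_univ, true_and] at hA h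
  refine ⟨A, hA, fun B hB => ?_⟩
  have h1 := h _ (hA.inter hM hα hB)
  have h2 := Finset.eq_of_subset_of_card_le Finset.inter_subset_left h1
  rw [← h2]
  exact Finset.inter_subset_right

/-- Data of low enough precision are always shared. -/
theorem mem_of_precision_le (hM : M.Substitutes) {α : ℝ} (hα : 0 < α) {σ : Fin K → ℝ≥0}
    {E A : Finset (Fin K)} (hA : IsGreatest {A | M.IsBestShare α σ E A} A) {i : Fin K}
    (hi : i ∈ E) (h : M.precision i (σ i) ≤ 1 / (2 * α)) : i ∈ A := by
  by_contra hiA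
  -- The platform's gain of 1/2 outweighs the privacy loss, which is at most α times the precision;
  -- a tie suffices since A is the greatest optimum.
  have h1 : M.sharingValue α σ A ≤ M.sharingValue α σ (insert i A) := by
    have h2 := gain_add_sub_le (M.total_nonneg σ A) (M.precision_nonneg i (σ i))
    rw [← M.total_insert σ hiA, ← buyerInfo_eq_gain hM, ← buyerInfo_eq_gain hM] at h2
    have h3 := mul_le_mul_of_nonneg_left (h2.trans h) hα.le
    have h4 : α * (1 / (2 * α)) = 1 / 2 := by field_simp
    rw [sharingValue, sharingValue, Finset.card_insert_of_notMem hiA]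
    push_cast
    linarith
  have h2 : M.IsBestShare α σ E (insert i A) :=
    ⟨Finset.insert_subset hi hA.1.1, fun A' hA' => (hA.1.2 A' hA').trans h1⟩
  exact hiA (hA.2 h2 (Finset.mem_insert_self i A))

/-- Were the value nonnegative, S would itself be optimal among its subsets, and the greatest
optimum could not be empty. -/
theorem PrivacyConcerned.lt (hM : M.Substitutes) {α : ℝ} (h : M.PrivacyConcerned α)
    {S : Finset (Fin K)} (hS : S.Nonempty) : M.sharingValue α (fun _ => 0) S < 0 := by
  have h1 := h S
  by_contra! hlt
  have h2 : ∀ A' ⊆ S, M.sharingValue α (fun _ => 0) A' ≤ 0 := fun A' hA' => by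
    have := h1.1.2 A' hA'
    rwa [userUtility_eq M _ _ hA', userUtility_eq M _ _ (Finset.empty_subset S),
      sharingValue_empty hM] at this
  have h3 : S ∈ M.userEquilibria α (fun _ => 0) S := by
    refine ⟨subset_rfl, fun A' hA' => ?_⟩
    rw [userUtility_eq M _ _ hA', userUtility_eq M _ _ subset_rfl]
    exact (h2 A' hA').trans hlt
  have h4 := h1.2 h3
  exact hS.ne_empty (Finset.subset_empty.1 h4)

/-- The case of a single noise-free platform, which reveals γ_i² / 2. It makes γ_i nonzero and the
precision 1/(2α) attainable. -/
theorem PrivacyConcerned.half_lt (hM : M.Substitutes) {α : ℝ} (h : M.PrivacyConcerned α)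
    (i : Fin K) : 1 < α * M.corr i ^ 2 := by
  have h1 := h.lt hM (Finset.singleton_nonempty i)
  rw [sharingValue, buyerInfo_eq_gain hM, total, Finset.sum_singleton, Finset.card_singleton] at h1
  have h2 : gain (M.precision i 0) = M.corr i ^ 2 / 2 := by
    have := M.corr_sq_le_one i
    have : 2 - M.corr i ^ 2 ≠ 0 := by linarith
    rw [gain, precision]
    simp
    field_simp
    ring
  rw [h2] at h1
  push_cast at h1
  linarith

end Market

/-! ### Uniqueness of the outcome of the pricing and purchase stages. -/

namespace Market

variable {d K : ℕ} {M : Market d K}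

/-- The competitive price of the data of platform `i` when those of `A` are offered. -/
noncomputable def competitivePrice (M : Market d K) (β : ℝ) (σ : Fin K → ℝ≥0) (A : Finset (Fin K))
    (i : Fin K) : ℝ := β * (M.buyerInfo σ A - M.buyerInfo σ (A.erase i))

theorem competitivePrice_pos (hM : M.Substitutes) (hc : ∀ i, M.corr i ≠ 0) {β : ℝ} (hβ : 0 < β)
    (σ : Fin K → ℝ≥0) {A : Finset (Fin K)} {i : Fin K} (hi : i ∈ A) :
    0 < M.competitivePrice β σ A i :=
  mul_pos hβ (sub_pos.2 (buyerInfo_erase_lt hM hc σ hi))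

theorem competitivePrice_lt (hM : M.Substitutes) {β : ℝ} (hβ : 0 < β)
    (σ : Fin K → ℝ≥0) (A : Finset (Fin K)) (i : Fin K) : M.competitivePrice β σ A i < β := by
  have h1 := buyerInfo_lt_one hM σ A
  have h2 := buyerInfo_nonneg hM σ (A.erase i)
  rw [competitivePrice]
  nlinarith

/-- The payoff of platform `i` when the user shares with the subset `A` of the entrants `E` and
prices are competitive. -/
noncomputable def competitivePayoff (M : Market d K) (β : ℝ) (σ : Fin K → ℝ≥0)
    (E A : Finset (Fin K)) (i : Fin K) : ℝ :=
  if i ∈ A then 1 / 2 + M.competitivePrice β σ A i - M.c i else if i ∈ E then - M.c i else 0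

theorem sum_competitivePrice_le (hM : M.Substitutes) {β : ℝ} (hβ : 0 < β)
    (σ : Fin K → ℝ≥0) {A B : Finset (Fin K)} (hBA : B ⊆ A) :
    ∑ i ∈ A \ B, M.competitivePrice β σ A i ≤ β * (M.buyerInfo σ A - M.buyerInfo σ B) := by
  simp only [competitivePrice]
  rw [← Finset.mul_sum]
  exact mul_le_mul_of_nonneg_left (sum_marginal_le hM σ hBA) hβ.le

namespace IsEquilibrium

variable {α β : ℝ} {s : Profile K}

/-- A buyer purchases the data of a platform that asks for less than the competitive price. -/
theorem mem_buy (hM : M.Substitutes) (hβ : 0 < β) (hs : M.IsEquilibrium α β s)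
    (σ : Fin K → ℝ≥0) {E A : Finset (Fin K)} (hA : A ⊆ E) (p : Fin K → ℝ) {i : Fin K}
    (hi : i ∈ A) (hp : p i < M.competitivePrice β σ A i) : i ∈ s.buy σ E A p := by
  by_contra hiB
  obtain ⟨h1, h2⟩ := hs.buyer σ E A hA p
  set B := s.buy σ E A p
  have hBA : insert i B ⊆ A := Finset.insert_subset hi h1
  have h3 := h2 _ hBA
  rw [buyerUtility_eq M hA hBA, buyerUtility_eq M hA h1, Finset.sum_insert hiB] at h3
  have h4 := buyerInfo_sub_erase_le hM σ hBA (Finset.mem_insert_self i B)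
  rw [Finset.erase_insert hiB] at h4
  have h5 := mul_le_mul_of_nonneg_left h4 hβ.le
  rw [competitivePrice] at hp
  linarith

theorem buyAfter_eq_and_price_eq (hM : M.Substitutes) (hc : ∀ i, M.corr i ≠ 0) (hβ : 0 < β)
    (hs : M.IsEquilibrium α β s) (σ : Fin K → ℝ≥0) {E A : Finset (Fin K)} (hA : A ⊆ E) :
    s.buyAfter σ E A = A ∧ ∀ i ∈ A, s.price σ E A i = M.competitivePrice β σ A i := by
  set p := s.price σ E A with hp
  -- Any price below the competitive one sells, so equilibrium revenue is at least every such price.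
  have hrev : ∀ i ∈ A, M.competitivePrice β σ A i ≤
      if i ∈ s.buy σ E A p then p i else 0 := by
    intro i hi
    refine le_of_forall_lt_imp_le_of_dense fun q hq => ?_
    have h1 := hs.pricing σ E A hA i q
    have h2 := hs.mem_buy hM hβ σ hA (Function.update p i q) hi (by simpa using hq)
    simp only [platformUtility, if_pos (hA hi), if_pos hi, ← hp, if_pos h2,
      Function.update_self] at h1
    linarith
  have hmem : ∀ i ∈ A, i ∈ s.buy σ E A p := by
    intro i hi
    by_contra hiB
    have := hrev i hi
    rw [if_neg hiB] at this
    exact (competitivePrice_pos hM hc hβ σ hi).not_ge this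
  obtain ⟨h1, h2⟩ := hs.buyer σ E A hA p
  have hbuy : s.buy σ E A p = A := h1.antisymm hmem
  refine ⟨hbuy, fun i hi => le_antisymm ?_ ?_⟩
  · have h3 := h2 _ (Finset.erase_subset i A)
    rw [hbuy, buyerUtility_eq M hA (Finset.erase_subset i A), buyerUtility_eq M hA subset_rfl,
      ← Finset.add_sum_erase A p hi] at h3
    rw [competitivePrice]
    linarith
  · have := hrev i hi
    rwa [if_pos (hmem i hi)] at this

theorem isGreatest_share (hM : M.Substitutes) (hc : ∀ i, M.corr i ≠ 0) (hβ : 0 < β)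
    (hs : M.IsEquilibrium α β s) (σ : Fin K → ℝ≥0) (E : Finset (Fin K)) :
    IsGreatest {A | M.IsBestShare α σ E A} (s.share σ E) := by
  convert hs.user σ E using 2
  ext A
  refine and_congr_right fun hA => forall₂_congr fun A' hA' => ?_
  rw [(hs.buyAfter_eq_and_price_eq hM hc hβ σ hA).1,
    (hs.buyAfter_eq_and_price_eq hM hc hβ σ hA').1, userUtility_eq M _ _ hA,
    userUtility_eq M _ _ hA']

theorem continuationPayoff_eq (hM : M.Substitutes) (hc : ∀ i, M.corr i ≠ 0) (hβ : 0 < β)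
    (hs : M.IsEquilibrium α β s) (σ : Fin K → ℝ≥0) (E : Finset (Fin K)) (i : Fin K) :
    M.continuationPayoff s i σ E = M.competitivePayoff β σ E (s.share σ E) i := by
  have hA := (hs.isGreatest_share hM hc hβ σ E).1.1
  obtain ⟨h1, h2⟩ := hs.buyAfter_eq_and_price_eq hM hc hβ σ hA
  rw [continuationPayoff, Profile.buyAt, h1, platformUtility, Profile.priceAt, competitivePayoff]
  by_cases hi : i ∈ s.share σ E
  · simp only [if_pos hi, if_pos (hA hi), h2 i hi, platformInfo_eq]
  · simp only [if_neg hi]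
    split_ifs <;> ring

end IsEquilibrium

/-- The later stages can always be completed, so existence reduces to first-stage deviations
evaluated at competitive prices. -/
theorem exists_profile (hM : M.Substitutes) (hc : ∀ i, M.corr i ≠ 0) {α β : ℝ}
    (hα : 0 ≤ α) (hβ : 0 < β) (σ₀ : Fin K → ℝ≥0) (E₀ : Finset (Fin K))
    (h : ∀ A₀, IsGreatest {A | M.IsBestShare α σ₀ E₀ A} A₀ → ∀ (i : Fin K) (t : ℝ≥0)
      (E : Finset (Fin K)), (E = insert i E₀ ∨ E = E₀.erase i) → ∀ A,
      IsGreatest {A | M.IsBestShare α (Function.update σ₀ i t) E A} A →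
      M.competitivePayoff β (Function.update σ₀ i t) E A i ≤ M.competitivePayoff β σ₀ E₀ A₀ i) :
    ∃ s, M.IsEquilibrium α β s := by
  classical
  choose share hshare using exists_greatest_isBestShare hM hα
  -- At competitive prices the buyer is indifferent about dropping any one platform, so ties must be
  -- broken toward the full offer.
  have hbuy : ∀ (σ : Fin K → ℝ≥0) (E A : Finset (Fin K)) (p : Fin K → ℝ), ∃ B ⊆ A,
      (∀ B' ⊆ A, M.buyerUtility β σ E A p B' ≤ M.buyerUtility β σ E A p B) ∧
      ((∀ B' ⊆ A, M.buyerUtility β σ E A p B' ≤ M.buyerUtility β σ E A p A) → B = A) := by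
    intro σ E A p
    by_cases hmax : ∀ B' ⊆ A, M.buyerUtility β σ E A p B' ≤ M.buyerUtility β σ E A p A
    · exact ⟨A, subset_rfl, hmax, fun _ => rfl⟩
    · obtain ⟨B, hB, hB'⟩ := Finset.exists_max_image A.powerset (M.buyerUtility β σ E A p)
        ⟨∅, by simp⟩
      exact ⟨B, by simpa using hB, fun B' h => hB' B' (by simpa using h), fun h => (hmax h).elim⟩
  choose buy hbuyA hbuymax hbuyeq using hbuy
  let s : Profile K := ⟨σ₀, E₀, share, fun σ _ A => M.competitivePrice β σ A, buy⟩
  have hbuyAfter : ∀ (σ : Fin K → ℝ≥0) (E A : Finset (Fin K)), A ⊆ E →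
      buy σ E A (M.competitivePrice β σ A) = A := by
    intro σ E A hA
    refine hbuyeq _ _ _ _ fun B hB => ?_
    rw [buyerUtility_eq M hA hB, buyerUtility_eq M hA subset_rfl]
    have h1 := sum_competitivePrice_le hM hβ σ hB
    have h2 := Finset.sum_sdiff (f := M.competitivePrice β σ A) hB
    linarith
  have hcont : ∀ (σ : Fin K → ℝ≥0) (E : Finset (Fin K)) (i : Fin K),
      M.continuationPayoff s i σ E = M.competitivePayoff β σ E (share σ E) i := by
    intro σ E i
    have hA := (hshare σ E).1.1
    have h1 : s.buyAt σ E = share σ E := hbuyAfter σ E _ hA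
    rw [continuationPayoff, h1, platformUtility, competitivePayoff]
    by_cases hi : i ∈ share σ E
    · simp only [s, Profile.priceAt, if_pos hi, if_pos (hA hi), platformInfo_eq]
    · simp only [s, if_neg hi]
      split_ifs <;> ring
  refine ⟨s, fun σ E A _ p => ⟨hbuyA σ E A p, hbuymax σ E A p⟩, ?_, ?_, ?_⟩
  · intro σ E A hA i q
    change M.platformUtility i E A (Function.update (M.competitivePrice β σ A) i q)
      (buy σ E A (Function.update (M.competitivePrice β σ A) i q)) ≤
      M.platformUtility i E A (M.competitivePrice β σ A) (buy σ E A (M.competitivePrice β σ A))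
    rw [hbuyAfter σ E A hA]
    set p := Function.update (M.competitivePrice β σ A) i q with hp
    have hBA := hbuyA σ E A p
    have hmax := hbuymax σ E A p
    set B := buy σ E A p
    by_cases hiA : i ∈ A
    · simp only [platformUtility, if_pos (hA hiA), if_pos hiA]
      have hpos := competitivePrice_pos hM hc hβ σ hiA
      by_cases hiB : i ∈ B
      · simp only [if_pos hiB]
        -- Dropping i from A leaves the buyer as well off as all of A at competitive prices; so a
        -- bundle containing i is chosen only if q does not exceed the competitive price.
        have h1 := hmax _ (Finset.erase_subset i A)
        rw [buyerUtility_eq M hA (Finset.erase_subset i A), buyerUtility_eq M hA hBA,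
          ← Finset.add_sum_erase B p hiB] at h1
        have hpe : ∀ S : Finset (Fin K), ∑ j ∈ S.erase i, p j =
            ∑ j ∈ S.erase i, M.competitivePrice β σ A j := fun S =>
          Finset.sum_congr rfl fun j hj => by
            rw [hp, Function.update_of_ne (Finset.ne_of_mem_erase hj)]
        rw [hpe, hpe] at h1
        have h2 := sum_competitivePrice_le hM hβ σ hBA
        have h3 := Finset.sum_sdiff (f := M.competitivePrice β σ A) hBA
        rw [← Finset.add_sum_erase A _ hiA, ← Finset.add_sum_erase B _ hiB] at h3
        have h4 : M.competitivePrice β σ A i =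
          β * (M.buyerInfo σ A - M.buyerInfo σ (A.erase i)) := rfl
        linarith
      · simp only [if_neg hiB]
        linarith
    · have hiB : i ∉ B := fun h => hiA (hBA h)
      simp only [platformUtility, if_neg hiA, if_neg hiB, le_refl]
  · intro σ E
    convert hshare σ E using 2
    ext A
    refine and_congr_right fun hA => forall₂_congr fun A' hA' => ?_
    rw [show s.buyAfter σ E A = A from hbuyAfter σ E A hA,
      show s.buyAfter σ E A' = A' from hbuyAfter σ E A' hA', userUtility_eq M _ _ hA,
      userUtility_eq M _ _ hA']
  · intro i t E hE
    rw [hcont, hcont]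
    exact h _ (hshare σ₀ E₀) i t E hE _ (hshare _ E)

theorem PrivacyConcerned.pos (hM : M.Substitutes) {α : ℝ} (h : M.PrivacyConcerned α)
    (hK : 0 < K) : 0 < α := by
  have h1 := h.half_lt hM ⟨0, hK⟩
  by_contra! h2
  nlinarith [sq_nonneg (M.corr ⟨0, hK⟩)]

theorem PrivacyConcerned.corr_ne_zero (hM : M.Substitutes) {α : ℝ} (h : M.PrivacyConcerned α)
    (i : Fin K) : M.corr i ≠ 0 := by
  intro h0
  have h1 := h.half_lt hM i
  rw [h0] at h1
  norm_num at h1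

theorem competitivePrice_ge (hM : M.Substitutes) {β e : ℝ} (hβ : 0 < β) (σ : Fin K → ℝ≥0)
    {A : Finset (Fin K)} {i : Fin K} (hi : i ∈ A) (he : 0 ≤ e) (h : e ≤ M.precision i (σ i)) :
    β * (e / ((K + 1) * (K + 2))) ≤ M.competitivePrice β σ A i := by
  refine mul_le_mul_of_nonneg_left ?_ hβ.le
  rw [buyerInfo_eq_gain hM, buyerInfo_eq_gain hM, ← M.total_erase_add σ hi]
  exact gain_add_sub_ge (M.total_nonneg _ _) (M.total_le _ _) he h
    (h.trans (M.precision_le_one i _))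

/-- Splitting the information in proportion to precision exhausts it, and with a rival present each
marginal contribution is strictly below its share. A lone seller instead extracts everything. -/
theorem sum_competitivePrice_lt (hM : M.Substitutes) (hc : ∀ i, M.corr i ≠ 0) {β : ℝ}
    (hβ : 0 < β) (σ : Fin K → ℝ≥0) {A : Finset (Fin K)} (hA : 2 ≤ A.card) :
    ∑ i ∈ A, M.competitivePrice β σ A i < β * M.buyerInfo σ A := by
  have hne : A.Nonempty := Finset.card_pos.1 (by omega)
  have h1 : ∀ i ∈ A, M.competitivePrice β σ A i <
      β * (M.precision i (σ i) / (1 + M.total σ A)) := by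
    intro i hi
    have hW : 0 < M.total σ (A.erase i) := M.total_pos hc σ (by
      rw [← Finset.card_pos, Finset.card_erase_of_mem hi]; omega)
    have hr := M.precision_pos hc i (σ i)
    refine mul_lt_mul_of_pos_left ?_ hβ
    rw [buyerInfo_eq_gain hM, buyerInfo_eq_gain hM, ← M.total_erase_add σ hi,
      gain_sub hW.le (by positivity), add_sub_cancel_left]
    refine div_lt_div_of_pos_left hr (by positivity) ?_
    nlinarith
  refine (Finset.sum_lt_sum_of_nonempty hne h1).trans_eq ?_
  rw [← Finset.mul_sum, ← Finset.sum_div, buyerInfo_eq_gain hM]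
  rfl

theorem sum_competitivePrice_eq (hM : M.Substitutes) {β : ℝ} (σ : Fin K → ℝ≥0)
    {A : Finset (Fin K)} (hA : A.card < 2) :
    ∑ i ∈ A, M.competitivePrice β σ A i = β * M.buyerInfo σ A := by
  rcases A.eq_empty_or_nonempty with rfl | hne
  · simp [buyerInfo_empty hM]
  · obtain ⟨i, rfl⟩ := Finset.card_eq_one.1 (show A.card = 1 by
      have := Finset.card_pos.2 hne; omega)
    simp [competitivePrice, buyerInfo_empty hM]

/-! ### Necessary properties of every equilibrium. -/

namespace IsEquilibrium

variable {α β : ℝ} {s : Profile K}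

/-- When the user shares with all the entrants, she gets nothing from it. -/
theorem sharingValue_entry_eq_zero (hM : M.Substitutes) (hα : 0 < α) (hP : M.PrivacyConcerned α)
    (hβ : 0 < β) (hs : M.IsEquilibrium α β s) (hE : s.share s.noise s.entry = s.entry) :
    M.sharingValue α s.noise s.entry = 0 := by
  have hc := hP.corr_ne_zero hM
  set σ := s.noise with hσ
  set E := s.entry with hEdef
  have hbest : M.IsBestShare α σ E E := by
    have := (hs.isGreatest_share hM hc hβ σ E).1
    rwa [hE] at this
  have hnonneg : 0 ≤ M.sharingValue α σ E := by
    have := hbest.2 ∅ (Finset.empty_subset _)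
    rwa [sharingValue_empty hM] at this
  by_contra hne
  have hpos : 0 < M.sharingValue α σ E := lt_of_le_of_ne hnonneg (Ne.symm hne)
  -- Otherwise all sets without i are strictly worse than E, and by continuity remain so after a
  -- slight cut in the noise of i, which would then raise its price.
  have hfree : ∀ i ∈ E, 0 < σ i → ∃ S, M.IsBestShare α σ E S ∧ i ∉ S := by
    intro i hi hσi
    by_contra! hall
    have hlt : ∀ S ∈ (E.erase i).powerset, M.sharingValue α σ S < M.sharingValue α σ E := by
      intro S hS
      have hSE : S ⊆ E.erase i := Finset.mem_powerset.1 hS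
      by_contra! hle
      have := hall S ⟨hSE.trans (Finset.erase_subset _ _), fun A' hA' => (hbest.2 A' hA').trans hle⟩
      exact Finset.notMem_erase i E (hSE this)
    have hcont : Continuous fun t => M.sharingValue α (Function.update σ i t) E := by
      have : (fun t => M.sharingValue α (Function.update σ i t) E) = fun t =>
          (E.card / 2 : ℝ) - α * gain (M.total σ (E.erase i) + M.precision i t) := by
        funext t
        rw [sharingValue, buyerInfo_eq_gain hM, ← M.total_erase_add _ hi, Function.update_self]
        congr 4
        exact M.total_congr fun j hj => Function.update_of_ne (Finset.ne_of_mem_erase hj) _ _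
      rw [this]
      refine continuous_const.sub (continuous_const.mul ?_)
      have hp := M.continuous_precision i
      refine (continuous_const.add hp).div (continuous_const.add (continuous_const.add hp))
        fun t => ?_
      have := M.total_nonneg σ (E.erase i)
      have := M.precision_nonneg i t
      positivity
    have hev : ∀ᶠ t in nhds (σ i), ∀ S ∈ (E.erase i).powerset,
        M.sharingValue α σ S < M.sharingValue α (Function.update σ i t) E := by
      rw [Filter.eventually_all_finset]
      intro S hS
      refine hcont.continuousAt.eventually_const_lt ?_
      simpa only [Function.update_eq_self] using hlt S hS
    have hne : (nhdsWithin (σ i) (Set.Iio (σ i))).NeBot := nhdsLT_neBot_of_exists_lt ⟨0, hσi⟩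
    obtain ⟨t, ht, hti⟩ := ((hev.filter_mono nhdsWithin_le_nhds).and
      (self_mem_nhdsWithin : Set.Iio (σ i) ∈ nhdsWithin (σ i) (Set.Iio (σ i)))).exists
    have hdev := hs.platform i t E (Or.inl (Finset.insert_eq_self.2 hi).symm)
    rw [hs.continuationPayoff_eq hM hc hβ, hs.continuationPayoff_eq hM hc hβ, ← hσ, ← hEdef,
      hE] at hdev
    have hA := hs.isGreatest_share hM hc hβ (Function.update σ i t) E
    set A := s.share (Function.update σ i t) E
    -- The value of a set without i does not depend on the noise of i, so such sets still lose to E.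
    have hiA : i ∈ A := by
      by_contra hiA
      have h1 := ht A (Finset.mem_powerset.2 (Finset.subset_erase.2 ⟨hA.1.1, hiA⟩))
      have h2 := hA.1.2 E subset_rfl
      have h3 : M.sharingValue α (Function.update σ i t) A = M.sharingValue α σ A :=
        sharingValue_congr hM fun j hj => Function.update_of_ne (ne_of_mem_of_not_mem hj hiA) _ _
      linarith
    rw [competitivePayoff, competitivePayoff, if_pos hiA, if_pos hi] at hdev
    -- If the user drops rivals after the deviation, submodularity can only raise the price of i.
    have h1 : M.competitivePrice β (Function.update σ i t) E i ≤
        M.competitivePrice β (Function.update σ i t) A i :=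
      mul_le_mul_of_nonneg_left (buyerInfo_sub_erase_le hM _ hA.1.1 hiA) hβ.le
    have h2 : M.competitivePrice β σ E i <
        M.competitivePrice β (Function.update σ i t) E i := by
      have e : M.buyerInfo (Function.update σ i t) (E.erase i) = M.buyerInfo σ (E.erase i) :=
        buyerInfo_congr hM fun j hj => Function.update_of_ne (Finset.ne_of_mem_erase hj) _ _
      refine mul_lt_mul_of_pos_left ?_ hβ
      rw [e]
      refine sub_lt_sub_right ?_ _
      rw [buyerInfo_eq_gain hM, buyerInfo_eq_gain hM]
      refine gain_lt (M.total_nonneg _ _) ?_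
      rw [← M.total_erase_add _ hi, ← M.total_erase_add (Function.update σ i t) hi,
        Function.update_self,
        M.total_congr fun j hj => Function.update_of_ne (Finset.ne_of_mem_erase hj) t σ]
      have := M.precision_strictAnti hc i hti
      linarith
    linarith
  obtain ⟨S, hS, hSle⟩ := exists_least_isBestShare hM hα.le σ E
  have hzero : ∀ i ∈ S, σ i = 0 := by
    intro i hi
    by_contra h0
    obtain ⟨S', hS', hiS'⟩ := hfree i (hS.1 hi) (pos_iff_ne_zero.2 h0)
    exact hiS' (hSle hS' hi)
  have hSpos : 0 < M.sharingValue α σ S := hpos.trans_le (hS.2 E subset_rfl)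
  rcases S.eq_empty_or_nonempty with rfl | hne
  · rw [sharingValue_empty hM] at hSpos
    exact hSpos.false
  · have h1 := hP.lt hM hne
    rw [sharingValue_congr hM hzero] at hSpos
    exact hSpos.not_gt h1

/-- A platform in D could secure a positive payoff by entering with precision 1/(2α), so it must
enter and be shared with; one outside D would lose by entering, as its price is below β. -/
theorem entry_eq (hM : M.Substitutes) (hα : 0 < α) (hP : M.PrivacyConcerned α) (hβ : 0 < β)
    (hs : M.IsEquilibrium α β s) {D : Finset (Fin K)}
    (hin : ∀ i ∈ D, 0 < 1 / 2 - M.c i + β * (1 / (2 * α) / ((K + 1) * (K + 2))))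
    (hout : ∀ i, i ∉ D → 1 / 2 + β ≤ M.c i) :
    s.entry = D ∧ s.share s.noise s.entry = s.entry := by
  have hc := hP.corr_ne_zero hM
  have hshare := (hs.isGreatest_share hM hc hβ s.noise s.entry).1.1
  have hD : D ⊆ s.share s.noise s.entry := by
    intro i hi
    have h1 := hP.half_lt hM i
    obtain ⟨t, ht⟩ := M.exists_precision_eq i (r := 1 / (2 * α)) (by positivity) (by
      rw [div_le_div_iff₀ (by positivity) (by norm_num)]; nlinarith)
    have hdev := hs.platform i t _ (Or.inl rfl)
    rw [hs.continuationPayoff_eq hM hc hβ, hs.continuationPayoff_eq hM hc hβ] at hdev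
    have hA := hs.isGreatest_share hM hc hβ (Function.update s.noise i t) (insert i s.entry)
    have hr : M.precision i (Function.update s.noise i t i) = 1 / (2 * α) := by
      rw [Function.update_self, ht]
    have hiA := mem_of_precision_le hM hα hA (Finset.mem_insert_self _ _) hr.le
    have hprice := competitivePrice_ge hM hβ (Function.update s.noise i t) hiA
      (by positivity : 0 ≤ 1 / (2 * α)) hr.ge
    rw [competitivePayoff, if_pos hiA] at hdev
    have hpos := hin i hi
    by_contra hiE
    rw [competitivePayoff, if_neg hiE] at hdev
    have := M.c_nonneg i
    split_ifs at hdev <;> linarith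
  have hE : s.entry ⊆ D := by
    intro i hi
    by_contra hiD
    have hci := hout i hiD
    have hdev := hs.platform i (s.noise i) _ (Or.inr rfl)
    rw [hs.continuationPayoff_eq hM hc hβ, hs.continuationPayoff_eq hM hc hβ,
      Function.update_eq_self] at hdev
    have h1 : i ∉ s.share s.noise (s.entry.erase i) := fun h =>
      Finset.notMem_erase i _ ((hs.isGreatest_share hM hc hβ s.noise _).1.1 h)
    rw [competitivePayoff, competitivePayoff, if_neg h1, if_neg (Finset.notMem_erase i _),
      if_pos hi] at hdev
    have := competitivePrice_lt hM hβ s.noise (s.share s.noise s.entry) i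
    split_ifs at hdev <;> linarith
  exact ⟨hE.antisymm (hD.trans hshare), hshare.antisymm (hE.trans hD)⟩

theorem outcome (hM : M.Substitutes) (hα : 0 < α) (hP : M.PrivacyConcerned α) (hβ : 0 < β)
    (hs : M.IsEquilibrium α β s) {D : Finset (Fin K)}
    (hin : ∀ i ∈ D, 0 < 1 / 2 - M.c i + β * (1 / (2 * α) / ((K + 1) * (K + 2))))
    (hout : ∀ i, i ∉ D → 1 / 2 + β ≤ M.c i) :
    s.entry = D ∧ M.userOutcome α s = 0 ∧ s.purchased = D ∧
      (0 < M.buyerOutcome β s ↔ 2 ≤ D.card) := by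
  have hc := hP.corr_ne_zero hM
  obtain ⟨hE, hA⟩ := hs.entry_eq hM hα hP hβ hin hout
  have hU := hs.sharingValue_entry_eq_zero hM hα hP hβ hA
  obtain ⟨hB, hp⟩ := hs.buyAfter_eq_and_price_eq hM hc hβ s.noise (subset_refl s.entry)
  have hpur : s.purchased = s.entry := by
    rw [Profile.purchased, Profile.buyAt, hA, hB]
  refine ⟨hE, ?_, hpur.trans hE, ?_⟩
  · rw [userOutcome, hA, hpur, userUtility_eq M _ _ subset_rfl, hU]
  · rw [buyerOutcome, hA, hpur, buyerUtility_eq M subset_rfl subset_rfl, Profile.priceAt, hA,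
      Finset.sum_congr rfl hp, ← hE, sub_pos]
    constructor
    · intro h
      by_contra! hcard
      exact h.ne (sum_competitivePrice_eq hM s.noise hcard)
    · exact sum_competitivePrice_lt hM hc hβ s.noise

end IsEquilibrium

end Market

/-! ### Existence through a symmetric configuration. -/

/-- With e = 1/(2α) and b = |D| e, sharing with m ≤ |D| symmetric platforms costs the user at least
the m/2 that it brings; equality holds at m = |D|. -/
theorem le_gain_mul {m e r b : ℝ} (hm : 0 ≤ m) (he : 0 < e) (hb : 0 < 1 - b) (hmb : m * e ≤ b)
    (hr : r = e / (1 - b)) : m * e ≤ gain (m * r) := by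
  have h0 : 0 < 1 - b + m * e := by positivity
  have h1 : gain (m * r) = m * e / (1 - b + m * e) := by
    rw [gain, hr]
    field_simp
  rw [h1, le_div_iff₀ h0]
  nlinarith [mul_nonneg hm he.le]

/-- In the symmetric configuration, a platform that adds noise so as to drive others out of the
market gets a lower price. -/
theorem gain_deviation_le {N k : ℕ} (hk : k ≤ N) {e r x : ℝ} (he : 0 < e)
    (hNe : (N + 1) * e ≤ 1 / 4) (hr : r = e / (1 - (N + 1) * e)) (hx : 0 < x)
    (h0 : gain (k * r + x) ≤ (k + 1) * e)
    (h1 : (N + 1) * e - gain (N * r + x) ≤ (k + 1) * e - gain (k * r + x)) :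
    gain (k * r + x) - gain (k * r) ≤ gain (N * r + r) - gain (N * r) := by
  have hc : 0 < 1 - (N + 1) * e := by linarith
  have hr0 : 0 < r := by rw [hr]; positivity
  have hrc : r * (1 - (N + 1) * e) = e := by
    rw [hr]; exact div_mul_cancel₀ _ hc.ne'
  have hkN : (k : ℝ) ≤ N := by exact_mod_cast hk
  have hk0 : (0 : ℝ) ≤ k := by positivity
  have hN0 : (0 : ℝ) ≤ N := by positivity
  rcases hk.eq_or_lt with rfl | hlt
  -- No rival is dropped: willingness to share then forces x ≤ r.
  · have h2 := le_gain_mul (m := k + 1) (by positivity) he hc le_rfl hr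
    have h3 := le_of_gain_le (by positivity) (h0.trans h2)
    have h4 := gain_le (s := k * r + x) (t := k * r + r) (by positivity) (by linarith)
    linarith
  · have hlt' : (k : ℝ) < N := by exact_mod_cast hlt
    have h2 := gain_sub (s := k * r + x) (t := N * r + x) (by positivity) (by positivity)
    have hP : 0 < (1 + (k * r + x)) * (1 + (N * r + x)) := by positivity
    have h3 : (N - k) * e ≤ (N - k) * r / ((1 + (k * r + x)) * (1 + (N * r + x))) := by
      have : (N : ℝ) * r + x - (k * r + x) = (N - k) * r := by ring
      rw [← this, ← h2]
      linarith
    rw [le_div_iff₀ hP, mul_assoc, mul_le_mul_iff_right₀ (by linarith)] at h3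
    -- Dropping N − k rivals is optimal only if their data reveal at least (N − k) e more; since r /
    -- e = 1 + (N + 1) r, this caps the product, and expanding it yields 2x ≤ r.
    have h4 : (1 + (k * r + x)) * (1 + (N * r + x)) ≤ 1 + (N + 1) * r := by
      have e1 : e * (1 + (N + 1) * r) = r := by linear_combination -hrc
      exact le_of_mul_le_mul_left (h3.trans_eq e1.symm) he
    have h5 : (1 + x) * (1 + (N * r + x)) ≤ (1 + (k * r + x)) * (1 + (N * r + x)) := by
      gcongr
      nlinarith [mul_nonneg hk0 hr0.le]
    have h6 : 2 * x ≤ r := by nlinarith [mul_nonneg (mul_nonneg hN0 hr0.le) hx.le, mul_pos hx hx]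
    have h7 := gain_add_sub_le (s := k * r) (x := x) (by positivity) hx.le
    -- From (N + 1) r ≤ 1/3, both factors of the denominator are at most 4/3; the resulting 9/16
    -- exceeds the 1/2 of `h6`.
    have h8 : r * (9 / 16) ≤ gain (N * r + r) - gain (N * r) := by
      rw [gain_sub (by positivity) (by positivity), add_sub_cancel_left, le_div_iff₀ (by positivity)]
      have h9 : (N + 1) * r ≤ 1 / 3 := by
        nlinarith
      have h10 : (1 + N * r) * (1 + (N * r + r)) ≤ 4 / 3 * (4 / 3) := by
        gcongr <;> nlinarith
      nlinarith
    linarith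

namespace Market

variable {d K : ℕ} {M : Market d K}

theorem exists_isEquilibrium (hM : M.Substitutes) {α β : ℝ} (hα : 0 < α) (hαK : 2 * K ≤ α)
    (hcap : ∀ i, 4 / 3 ≤ α * M.corr i ^ 2) (hc : ∀ i, M.corr i ≠ 0) (hβ : 0 < β)
    {D : Finset (Fin K)}
    (hin : ∀ i ∈ D, 0 < 1 / 2 - M.c i + β * (1 / (2 * α) / ((K + 1) * (K + 2))))
    (hout : ∀ i, i ∉ D → 1 / 2 + β ≤ M.c i) :
    ∃ s, M.IsEquilibrium α β s := by
  obtain ⟨e, he⟩ : ∃ e, e = 1 / (2 * α) := ⟨_, rfl⟩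
  rw [← he] at hin
  have he0 : 0 < e := by rw [he]; positivity
  have hαe : α * e = 1 / 2 := by rw [he]; field_simp
  have hDK : (D.card : ℝ) ≤ K := by
    exact_mod_cast (by simpa using Finset.card_le_univ D : D.card ≤ K)
  have hDe : D.card * e ≤ 1 / 4 := by
    have h1 : (D.card : ℝ) * e ≤ K * e := by gcongr
    have h2 : 2 * K * e ≤ α * e := by gcongr
    linarith
  -- The solution of `gain` (|D| r) = |D| e, where the user is indifferent between sharing with all
  -- of D and with nobody.
  obtain ⟨r, hr⟩ : ∃ r, r = e / (1 - D.card * e) := ⟨_, rfl⟩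
  have hden : 0 < 1 - D.card * e := by linarith
  have hr0 : 0 < r := by rw [hr]; positivity
  have her : e ≤ r := by
    rw [hr, le_div_iff₀ hden]
    nlinarith [mul_nonneg (Nat.cast_nonneg D.card : (0 : ℝ) ≤ D.card) he0.le]
  -- The factor 4/3 comes from |D| e ≤ 1/4 and is matched by `hcap`, so that r is attainable by
  -- every platform.
  have hrcap : r ≤ 4 / 3 * e := by
    rw [hr, div_le_iff₀ hden]
    nlinarith
  have hcap' : ∀ i, r ≤ M.corr i ^ 2 / 2 := fun i => by
    have h1 := mul_le_mul_of_nonneg_right (hcap i) he0.le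
    have h2 : α * M.corr i ^ 2 * e = M.corr i ^ 2 / 2 := by linear_combination M.corr i ^ 2 * hαe
    linarith
  choose σ hσ using fun i => M.exists_precision_eq i hr0 (hcap' i)
  have htotal : ∀ S, M.total σ S = S.card * r := fun S => by simp [total, hσ]
  have hvalue : ∀ S ⊆ D, M.sharingValue α σ S ≤ 0 := fun S hS => by
    have hcard : (S.card : ℝ) ≤ D.card := by exact_mod_cast Finset.card_le_card hS
    have h1 := le_gain_mul (m := S.card) (by positivity) he0 hden (by gcongr) hr
    rw [sharingValue, buyerInfo_eq_gain hM, htotal]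
    have h2 := mul_le_mul_of_nonneg_left h1 hα.le
    have h3 : α * (S.card * e) = S.card / 2 := by linear_combination (S.card : ℝ) * hαe
    linarith
  have hvalueD : M.sharingValue α σ D = 0 := by
    rw [sharingValue, buyerInfo_eq_gain hM, htotal, gain]
    have h1 : D.card * r / (1 + D.card * r) = D.card * e := by
      rw [hr]
      field_simp
      ring
    rw [h1]
    linear_combination -(D.card : ℝ) * hαe
  have hbestD : M.IsBestShare α σ D D :=
    ⟨subset_rfl, fun S hS => (hvalue S hS).trans hvalueD.ge⟩
  refine exists_profile hM hc hα.le hβ σ D fun A₀ hA₀ i t E hE A hA => ?_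
  obtain rfl : A₀ = D := hA₀.1.1.antisymm (hA₀.2 hbestD)
  have hci := M.c_nonneg i
  by_cases hiD : i ∈ A₀
  · have hprice := competitivePrice_ge hM hβ σ hiD he0.le (by rw [hσ]; exact her)
    have hpos := hin i hiD
    rw [competitivePayoff, competitivePayoff, if_pos hiD]
    by_cases hiA : i ∈ A
    · rw [if_pos hiA]
      obtain rfl : E = A₀ := by
        rcases hE with rfl | rfl
        · exact Finset.insert_eq_self.2 hiD
        · exact absurd (hA.1.1 hiA) (Finset.notMem_erase i _)
      have hupd : ∀ S : Finset (Fin K),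
          M.total (Function.update σ i t) (S.erase i) = (S.erase i).card * r := by
        intro S
        rw [← htotal]
        exact M.total_congr fun j hj => Function.update_of_ne (Finset.ne_of_mem_erase hj) _ _
      have hupd' : ∀ S : Finset (Fin K), i ∈ S →
          M.total (Function.update σ i t) S = (S.erase i).card * r + M.precision i t := by
        intro S hS
        rw [← M.total_erase_add _ hS, hupd, Function.update_self]
      have hcard : ∀ S : Finset (Fin K), i ∈ S → (S.card : ℝ) = (S.erase i).card + 1 :=
        fun S hS => by exact_mod_cast (Finset.card_erase_add_one hS).symm
      have hval : ∀ S : Finset (Fin K), i ∈ S → M.sharingValue α (Function.update σ i t) S =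
          α * (((S.erase i).card + 1) * e - gain ((S.erase i).card * r + M.precision i t)) := by
        intro S hS
        rw [sharingValue, buyerInfo_eq_gain hM, hupd' S hS, hcard S hS]
        linear_combination -((S.erase i).card + 1 : ℝ) * hαe
      -- Optimality of A against sharing with nobody and with everybody gives the two inequalities
      -- required by `gain_deviation_le`.
      have h0 := hA.1.2 ∅ (Finset.empty_subset _)
      have h1 := hA.1.2 E subset_rfl
      rw [sharingValue_empty hM, hval A hiA] at h0
      rw [hval E hiD, hval A hiA, mul_le_mul_iff_right₀ hα] at h1
      have h0' := nonneg_of_mul_nonneg_right h0 hα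
      have hsub := Finset.card_le_card (Finset.erase_subset_erase i hA.1.1)
      rw [hcard E hiD] at hDe hr
      have hdev := gain_deviation_le hsub he0 hDe hr (M.precision_pos hc i t) (by linarith) h1
      have hdev' : M.competitivePrice β (Function.update σ i t) A i ≤
          M.competitivePrice β σ E i := by
        refine mul_le_mul_of_nonneg_left ?_ hβ.le
        simp only [buyerInfo_eq_gain hM]
        rw [hupd, hupd' A hiA, ← M.total_erase_add σ hiD, hσ, htotal]
        exact hdev
      linarith
    · rw [if_neg hiA]
      split_ifs <;> linarith
  · have hci' := hout i hiD
    have hprice := competitivePrice_lt hM hβ (Function.update σ i t) A i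
    rw [competitivePayoff, competitivePayoff, if_neg hiD, if_neg hiD]
    split_ifs <;> linarith

theorem minCorr_le (i : Fin K) : M.minCorr ≤ |M.corr i| :=
  ciInf_le (Set.finite_range _).bddBelow i

theorem minCorr_pos [Nonempty (Fin K)] (hc : ∀ i, M.corr i ≠ 0) : 0 < M.minCorr := by
  obtain ⟨i, hi⟩ := exists_eq_ciInf_of_finite (f := fun i => |M.corr i|)
  rw [minCorr, ← hi]
  exact abs_pos.2 (hc i)

theorem two_le_mul_corr_sq [Nonempty (Fin K)] (hc : ∀ i, M.corr i ≠ 0) {α : ℝ}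
    (hα : 2 / M.minCorr ^ 2 ≤ α) (i : Fin K) : 2 ≤ α * M.corr i ^ 2 := by
  have h0 := M.minCorr_pos hc
  rw [div_le_iff₀ (by positivity)] at hα
  have hα0 : 0 ≤ α := by
    by_contra! h
    nlinarith [sq_nonneg M.minCorr]
  have h1 : M.minCorr ^ 2 ≤ M.corr i ^ 2 := by
    rw [← sq_abs (M.corr i)]
    gcongr
    exact M.minCorr_le i
  exact hα.trans (by gcongr)

end Market
end DataMarket

/-! ### The thresholds. -/

theorem theorem1 (K : ℕ) (hK : 2 ≤ K) :
    ∃ αbar : ℝ → ℝ, ∀ (d : ℕ) (M : DataMarket.Market d K), M.Substitutes →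
      ∃ βlow : ℝ, 0 < βlow ∧
        ∀ α : ℝ, αbar M.minCorr ≤ α → M.PrivacyConcerned α →
          ∃ βhigh : ℝ, ∀ β : ℝ, 0 < β →
            (βhigh ≤ β →
              (∃ s, M.IsEquilibrium α β s) ∧
              ∀ s, M.IsEquilibrium α β s →
                s.entry = Finset.univ ∧ M.userOutcome α s = 0 ∧
                  s.purchased = Finset.univ ∧ 0 < M.buyerOutcome β s) ∧
            (β ≤ βlow → (∀ i, M.c i ≠ 1 / 2) →
              (∃ s, M.IsEquilibrium α β s) ∧
              ∀ s, M.IsEquilibrium α β s →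
                s.entry = M.lowCost ∧ M.userOutcome α s = 0 ∧
                  s.purchased = M.lowCost ∧
                  (0 < M.buyerOutcome β s ↔ 2 ≤ M.lowCost.card)) := by
  have : Nonempty (Fin K) := ⟨⟨0, by omega⟩⟩
  -- The term 2K keeps |D| / (2α) at most 1/4; the term 2 / g² gives α γ_i² ≥ 2, more than the 4/3
  -- needed.
  refine ⟨fun g => 2 * K + 2 / g ^ 2, fun d M hM => ?_⟩
  -- The smallest excess of a high cost over 1/2, arbitrary if no cost is high: prices below it
  -- cannot pay for such a platform's entry.
  obtain ⟨b, hb0, hb⟩ : ∃ b : ℝ, 0 < b ∧ ∀ i, 1 / 2 < M.c i → 1 / 2 + b ≤ M.c i := by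
    rcases (Finset.univ.filter fun i => 1 / 2 < M.c i).eq_empty_or_nonempty with h | h
    · refine ⟨1, one_pos, fun i hi => ?_⟩
      exact absurd (Finset.mem_filter.2 ⟨Finset.mem_univ i, hi⟩) (h ▸ Finset.notMem_empty i)
    · obtain ⟨j, hj, hmin⟩ := Finset.exists_min_image _ M.c h
      have hj' := (Finset.mem_filter.1 hj).2
      refine ⟨M.c j - 1 / 2, by linarith, fun i hi => ?_⟩
      linarith [hmin i (Finset.mem_filter.2 ⟨Finset.mem_univ i, hi⟩)]
  refine ⟨b, hb0, fun α hα hP => ?_⟩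
  have hc := hP.corr_ne_zero hM
  have hα0 := hP.pos hM (by omega)
  have hK0 : (0 : ℝ) ≤ K := by positivity
  have hg : 0 ≤ 2 / M.minCorr ^ 2 := by positivity
  have hαK : 2 * K ≤ α := by linarith
  have hcap : ∀ i, 4 / 3 ≤ α * M.corr i ^ 2 := fun i => by
    linarith [DataMarket.Market.two_le_mul_corr_sq hc (by linarith) i]
  obtain ⟨u, hu, hu0⟩ : ∃ u, u = 1 / (2 * α) / ((K + 1) * (K + 2)) ∧ 0 < u :=
    ⟨_, rfl, by positivity⟩
  -- Beyond this threshold the guaranteed revenue β u covers every single cost.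
  refine ⟨(∑ i, M.c i) / u, fun β hβ => ⟨fun hβh => ?_, fun hβl hne => ?_⟩⟩
  · have hin : ∀ i ∈ (Finset.univ : Finset (Fin K)),
        0 < 1 / 2 - M.c i + β * (1 / (2 * α) / ((K + 1) * (K + 2))) := fun i hi => by
      rw [← hu]
      have h1 := Finset.single_le_sum (fun j _ => M.c_nonneg j) hi
      have h2 := (div_le_iff₀ hu0).1 hβh
      linarith
    have hout : ∀ i, i ∉ (Finset.univ : Finset (Fin K)) → 1 / 2 + β ≤ M.c i :=
      fun i hi => absurd (Finset.mem_univ i) hi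
    refine ⟨DataMarket.Market.exists_isEquilibrium hM hα0 hαK hcap hc hβ hin hout, fun s hs => ?_⟩
    obtain ⟨h1, h2, h3, h4⟩ := hs.outcome hM hα0 hP hβ hin hout
    exact ⟨h1, h2, h3, h4.2 (by simpa using hK)⟩
  · have hin : ∀ i ∈ M.lowCost,
        0 < 1 / 2 - M.c i + β * (1 / (2 * α) / ((K + 1) * (K + 2))) := fun i hi => by
      have h1 : M.c i < 1 / 2 := (Finset.mem_filter.1 hi).2
      have h2 : 0 < β * (1 / (2 * α) / ((K + 1) * (K + 2))) := by positivity
      linarith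
    have hout : ∀ i, i ∉ M.lowCost → 1 / 2 + β ≤ M.c i := fun i hi => by
      have h1 : ¬ M.c i < 1 / 2 := fun h => hi (Finset.mem_filter.2 ⟨Finset.mem_univ i, h⟩)
      have h2 := hb i (lt_of_le_of_ne (not_lt.1 h1) (hne i).symm)
      linarith
    exact ⟨DataMarket.Market.exists_isEquilibrium hM hα0 hαK hcap hc hβ hin hout,
      fun s hs => hs.outcome hM hα0 hP hβ hin hout⟩
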